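/- Let $\mathfrak g$ be a finite-dimensional complex semisimple Lie algebra with Cartan subalgebra $\mathfrak h$ and simple roots $\alpha_1,\dots,\alpha_N$, and let $(\cdot,\cdot)$ be a symmetric bilinear form on $\mathfrak h^*$ obtained from the Killing form by rescaling by a positive real constant on each simple ideal (for instance such that the shortest roots satisfy $(\alpha,\alpha)=2$). Let $P$ be the weight lattice, $d_i=(\alpha_i,\alpha_i)/2$, $a_{ij}=(\alpha_i,\alpha_j)/d_i$, and let $q=e^{h}$ with $h\in\mathbb R\setminus\{0\}$, $q^z=e^{hz}$ for $z\in\mathbb C$, $q_i=q^{d_i}$. Let $U_q(\mathfrak g)$ be the complex algebra with generators $K_\lambda$ ($\lambda\in P$), $E_i,F_i$ ($1\le i\le N$) and relations $$K_0=1,\quad K_\lambda K_\mu=K_{\lambda+\mu},\quad K_\lambda E_jK_\lambda^{-1}=q^{(\lambda,\alpha_j)}E_j,\quad K_\lambda F_jK_\lambda^{-1}=q^{-(\lambda,\alpha_j)}F_j,\quad [E_i,F_j]=\delta_{ij}\frac{K_{\alpha_i}-K_{\alpha_i}^{-1}}{q_i-q_i^{-1}},$$ together with the quantum Serre relations, for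 $i\ne j$, $$\sum_{k=0}^{1-a_{ij}}(-1)^k\begin{bmatrix}1-a_{ij}\\k\end{bmatrix}_{q_i}X_i^{1-a_{ij}-k}X_jX_i^k=0\qquad(X=E\text{ and }X=F).$$ Tensor products of $U_q(\mathfrak g)$-modules are formed over $\mathbb C$ through the comultiplication $K_\lambda\mapsto K_\lambda\otimes K_\lambda$, $E_i\mapsto E_i\otimes K_{\alpha_i}+1\otimes E_i$, $F_i\mapsto F_i\otimes1+K_{\alpha_i}^{-1}\otimes F_i$. The category $\mathcal O$ of $U_q(\mathfrak g)$ consists of the left modules $M$ that are finitely generated, are the direct sum of their weight spaces $\{v: K_\mu v=q^{(\lambda,\mu)}v\ \forall\mu\in P\}$ (with $\lambda\in\mathfrak h^*$, where linear forms $\lambda$ giving the same character $\mu\mapsto q^{(\lambda,\mu)}$ of $P$ are identified), and are such that $U_q(\mathfrak n_+)v$ is finite dimensional for every $v\in M$, where $U_q(\mathfrak n_+)$ is the subalgebra generated by the $E_i$. A module $M\in\mathcal O$ is called tensor-closed if $M\otimes N\in\mathcal O$ for every $N\in\mathcal O$. **Theorem.** A module $M\in\mathcal O$ is tensor-closed if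 and only if it is finite dimensional. The same holds in the unquantized case: a module $M$ in the BGG category $\mathcal O$ of $\mathfrak g$ (finitely generated over $U(\mathfrak g)$, a direct sum of weight spaces for $\mathfrak h$, and $U(\mathfrak n_+)v$ finite dimensional for every $v\in M$, where $\mathfrak n_+$ is spanned by the root spaces of the positive roots) satisfies $M\otimes N\in\mathcal O$ for every $N\in\mathcal O$ if and only if $M$ is finite dimensional. -/

import Mathlib

open scoped TensorProduct

universe u

noncomputable section

namespace CategoryO

/-! ### Quantum integers, binomial coefficients and the quantum Serre expression -/

section QuantumNumbers

/-- The quantum integer `[n]_q = (q ^ n - q ^ (-n)) / (q - q ^ (-1))`. -/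
def qInt (q : ℂ) (n : ℕ) : ℂ := (q ^ n - q⁻¹ ^ n) / (q - q⁻¹)

/-- The quantum factorial `[n]_q! = [1]_q [2]_q ... [n]_q`. -/
def qFactorial (q : ℂ) (n : ℕ) : ℂ := ∏ k ∈ Finset.range n, qInt q (k + 1)

/-- The quantum binomial coefficient `[n]_q! / ([k]_q! [n - k]_q!)`, used for `k ≤ n`. -/
def qBinom (q : ℂ) (n k : ℕ) : ℂ := qFactorial q n / (qFactorial q k * qFactorial q (n - k))

/-- The left-hand side `∑ k ≤ n, (-1) ^ k [n, k]_q x ^ (n - k) z x ^ k` of a quantum Serre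
relation. -/
def qSerre {A : Type*} [Ring A] [Algebra ℂ A] (q : ℂ) (n : ℕ) (x z : A) : A :=
  ∑ k ∈ Finset.range (n + 1), ((-1 : ℂ) ^ k * qBinom q n k) • (x ^ (n - k) * z * x ^ k)

theorem qInt_inv (q : ℂ) (n : ℕ) : qInt q⁻¹ n = qInt q n := by
  unfold qInt
  rw [inv_inv, ← neg_sub (q ^ n), ← neg_sub q, neg_div_neg_eq]

theorem qBinom_inv (q : ℂ) (n k : ℕ) : qBinom q⁻¹ n k = qBinom q n k := by
  simp only [qBinom, qFactorial, qInt_inv]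

theorem qInt_ne_zero {q : ℂ} (h0 : q ≠ 0) (hq : ∀ m : ℕ, 0 < m → q ^ (2 * m) ≠ 1)
    (m : ℕ) (hm : 0 < m) : qInt q m ≠ 0 := by
  have key : ∀ m : ℕ, 0 < m → q ^ m - q⁻¹ ^ m ≠ 0 := by
    intro m hm h
    apply hq m hm
    have h1 : q ^ m = q⁻¹ ^ m := sub_eq_zero.mp h
    rw [two_mul, pow_add]
    nth_rewrite 2 [h1]
    rw [← mul_pow, mul_inv_cancel₀ h0, one_pow]
  have h1 := key 1 one_pos
  rw [pow_one, pow_one] at h1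
  exact div_ne_zero (key m hm) h1

theorem qFactorial_ne_zero {q : ℂ} (h0 : q ≠ 0) (hq : ∀ m : ℕ, 0 < m → q ^ (2 * m) ≠ 1)
    (n : ℕ) : qFactorial q n ≠ 0 :=
  Finset.prod_ne_zero_iff.mpr fun k _ => qInt_ne_zero h0 hq (k + 1) k.succ_pos

theorem qFactorial_succ (q : ℂ) (n : ℕ) :
    qFactorial q (n + 1) = qFactorial q n * qInt q (n + 1) := by
  simp [qFactorial, Finset.prod_range_succ]

theorem qBinom_zero {q : ℂ} (h0 : q ≠ 0) (hq : ∀ m : ℕ, 0 < m → q ^ (2 * m) ≠ 1) (n : ℕ) :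
    qBinom q n 0 = 1 := by
  have := qFactorial_ne_zero h0 hq n
  rw [qBinom, Nat.sub_zero, show qFactorial q 0 = 1 from rfl, one_mul, div_self this]

theorem qBinom_self {q : ℂ} (h0 : q ≠ 0) (hq : ∀ m : ℕ, 0 < m → q ^ (2 * m) ≠ 1) (n : ℕ) :
    qBinom q n n = 1 := by
  have := qFactorial_ne_zero h0 hq n
  rw [qBinom, Nat.sub_self, show qFactorial q 0 = 1 from rfl, mul_one, div_self this]

theorem qInt_add {q : ℂ} (h0 : q ≠ 0) (a b : ℕ) :
    q ^ b * qInt q (a + b) = qInt q a + q ^ (a + b) * qInt q b := by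
  have hb : q ^ b ≠ 0 := pow_ne_zero _ h0
  have ha : q ^ a ≠ 0 := pow_ne_zero _ h0
  unfold qInt
  simp only [inv_pow, pow_add]
  rw [mul_div_assoc', mul_div_assoc', ← add_div]
  congr 1
  field_simp
  ring

/-- The quantum Pascal identity. -/
theorem qBinom_pascal {q : ℂ} (h0 : q ≠ 0) (hq : ∀ m : ℕ, 0 < m → q ^ (2 * m) ≠ 1)
    (m k : ℕ) (hk : k + 1 ≤ m) :
    q ^ (k + 1) * qBinom q (m + 1) (k + 1)
      = qBinom q m (k + 1) + q ^ (m + 1) * qBinom q m k := by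
  obtain ⟨j, rfl⟩ := Nat.exists_eq_add_of_le hk
  have e1 : k + 1 + j + 1 - (k + 1) = j + 1 := by omega
  have e2 : k + 1 + j - (k + 1) = j := by omega
  have e3 : k + 1 + j - k = j + 1 := by omega
  have hadd := qInt_add h0 (j + 1) (k + 1)
  rw [show j + 1 + (k + 1) = k + 1 + j + 1 by omega] at hadd
  unfold qBinom
  rw [e1, e2, e3, qFactorial_succ q (k + 1 + j), qFactorial_succ q k, qFactorial_succ q j]
  have h1 := qFactorial_ne_zero h0 hq k
  have h2 := qFactorial_ne_zero h0 hq j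
  have h3 := qInt_ne_zero h0 hq (k + 1) k.succ_pos
  have h4 := qInt_ne_zero h0 hq (j + 1) j.succ_pos
  rw [mul_div_assoc', mul_left_comm, hadd]
  field_simp

/-- Auxiliary iterated commutators, used to rewrite the quantum Serre expression. -/
def serreIter {A : Type*} [Ring A] [Algebra ℂ A] (c : ℕ → ℂ) (x z : A) : ℕ → A
  | 0 => z
  | m + 1 => x * serreIter c x z m - c m • (serreIter c x z m * x)

theorem serreIter_eq {A : Type*} [Ring A] [Algebra ℂ A] {q : ℂ} (h0 : q ≠ 0)
    (hq : ∀ m : ℕ, 0 < m → q ^ (2 * m) ≠ 1) (s : ℂ) (x z : A) (m : ℕ) :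
    serreIter (fun l => s * q ^ (2 * l + 1)) x z m =
      ∑ k ∈ Finset.range (m + 1),
        ((-1 : ℂ) ^ k * qBinom q m k * (s * q ^ m) ^ k) • (x ^ (m - k) * z * x ^ k) := by
  induction m with
  | zero => simp [serreIter, qBinom_zero h0 hq]
  | succ m ih =>
    have hl : x * serreIter (fun l => s * q ^ (2 * l + 1)) x z m = x ^ (m + 1) * z +
        ∑ k ∈ Finset.range m, ((-1 : ℂ) ^ (k + 1) * qBinom q m (k + 1) * (s * q ^ m) ^ (k + 1)) •
          (x ^ (m - k) * z * x ^ (k + 1)) := by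
      rw [ih, Finset.sum_range_succ', mul_add, Finset.mul_sum, add_comm]
      congr 1
      · simp [qBinom_zero h0 hq, pow_succ', mul_assoc]
      · refine Finset.sum_congr rfl fun k hk => ?_
        have : m - k = m - (k + 1) + 1 := by have := Finset.mem_range.mp hk; omega
        rw [mul_smul_comm, this, pow_succ' x (m - (k + 1))]
        simp only [mul_assoc]
    have hr : serreIter (fun l => s * q ^ (2 * l + 1)) x z m * x =
        (∑ k ∈ Finset.range m, ((-1 : ℂ) ^ k * qBinom q m k * (s * q ^ m) ^ k) •
          (x ^ (m - k) * z * x ^ (k + 1))) +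
        ((-1 : ℂ) ^ m * (s * q ^ m) ^ m) • (z * x ^ (m + 1)) := by
      rw [ih, Finset.sum_range_succ, add_mul, Finset.sum_mul]
      congr 1
      · refine Finset.sum_congr rfl fun k hk => ?_
        rw [smul_mul_assoc, pow_succ x k]
        simp only [mul_assoc]
      · simp [qBinom_self h0 hq, pow_succ, mul_assoc]
    rw [serreIter, hl, hr, Finset.sum_range_succ', Finset.sum_range_succ, smul_add, Finset.smul_sum,
      add_sub_assoc, ← sub_sub, ← Finset.sum_sub_distrib, add_comm]
    congr 1
    · rw [sub_eq_add_neg]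
      congr 1
      · refine Finset.sum_congr rfl fun k hk => ?_
        have hk' : k + 1 ≤ m := Finset.mem_range.mp hk
        have hp := qBinom_pascal h0 hq m k hk'
        rw [smul_smul, ← sub_smul, Nat.add_sub_add_right]
        congr 1
        have : (s * q ^ (m + 1)) ^ (k + 1) = (s * q ^ m) ^ (k + 1) * q ^ (k + 1) := by
          rw [pow_succ q m, ← mul_assoc, mul_pow]
        rw [this]
        linear_combination (-(-1 : ℂ) ^ (k + 1) * (s * q ^ m) ^ (k + 1)) * hp
      · rw [smul_smul, ← neg_smul, qBinom_self h0 hq]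
        simp only [Nat.sub_self, pow_zero, one_mul]
        congr 1
        rw [pow_succ q m, ← mul_assoc, mul_pow]
        ring
    · simp [qBinom_zero h0 hq]

theorem qSerre_eq_serreIter {A : Type*} [Ring A] [Algebra ℂ A] {q : ℂ} (h0 : q ≠ 0)
    (hq : ∀ m : ℕ, 0 < m → q ^ (2 * m) ≠ 1) (s : ℂ) (n : ℕ) (hs : s * q ^ n = 1) (x z : A) :
    qSerre q n x z = serreIter (fun l => s * q ^ (2 * l + 1)) x z n := by
  rw [serreIter_eq h0 hq, hs, qSerre]
  simp

theorem qSerre_inv {A : Type*} [Ring A] [Algebra ℂ A] (q : ℂ) (n : ℕ) (x z : A) :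
    qSerre q⁻¹ n x z = qSerre q n x z := by
  simp only [qSerre, qBinom_inv]

theorem qSerre_add_left {A : Type*} [Ring A] [Algebra ℂ A] {q : ℂ} (h0 : q ≠ 0)
    (hq : ∀ m : ℕ, 0 < m → q ^ (2 * m) ≠ 1) (s : ℂ) (n : ℕ) (hs : s * q ^ n = 1)
    (x y z : A) (hyx : y * x = (q ^ 2) • (x * y)) (hyz : y * z = (s * q) • (z * y)) :
    qSerre q n (x + y) z = qSerre q n x z := by
  rw [qSerre_eq_serreIter h0 hq s n hs, qSerre_eq_serreIter h0 hq s n hs]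
  have comm : ∀ m, y * serreIter (fun l => s * q ^ (2 * l + 1)) x z m =
      (s * q ^ (2 * m + 1)) • (serreIter (fun l => s * q ^ (2 * l + 1)) x z m * y) := by
    intro m
    induction m with
    | zero => simpa [serreIter] using hyz
    | succ m ih =>
      rw [serreIter]
      set w := serreIter (fun l => s * q ^ (2 * l + 1)) x z m
      have h1 : y * (x * w) = (s * q ^ (2 * (m + 1) + 1)) • (x * w * y) := by
        rw [← mul_assoc, hyx, smul_mul_assoc, mul_assoc x y w, ih, mul_smul_comm, smul_smul,
          mul_assoc x w y]
        congr 1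
        ring
      have h2 : y * (w * x) = (s * q ^ (2 * (m + 1) + 1)) • (w * x * y) := by
        rw [← mul_assoc, ih, smul_mul_assoc, mul_assoc w y x, hyx, mul_smul_comm, smul_smul,
          mul_assoc w x y]
        congr 1
        ring
      rw [mul_sub, mul_smul_comm, h1, h2, sub_mul, smul_mul_assoc, smul_sub, smul_comm]
  have main : ∀ m, serreIter (fun l => s * q ^ (2 * l + 1)) (x + y) z m =
      serreIter (fun l => s * q ^ (2 * l + 1)) x z m := by
    intro m
    induction m with
    | zero => rfl
    | succ m ih =>
      rw [serreIter, serreIter, ih, add_mul, mul_add, smul_add, comm m]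
      abel
  exact main n

theorem qSerre_add_right {A : Type*} [Ring A] [Algebra ℂ A] {q : ℂ} (h0 : q ≠ 0)
    (hq : ∀ m : ℕ, 0 < m → q ^ (2 * m) ≠ 1) (s : ℂ) (n : ℕ) (hs : s * q ^ n = 1)
    (x y z : A) (hyx : y * x = (q ^ 2) • (x * y)) (hzx : z * x = (s * q) • (x * z)) :
    qSerre q n (x + y) z = qSerre q n y z := by
  have hs0 : s ≠ 0 := left_ne_zero_of_mul_eq_one hs
  have hq' : ∀ m : ℕ, 0 < m → q⁻¹ ^ (2 * m) ≠ 1 := fun m hm h => hq m hm (by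
    rwa [inv_pow, inv_eq_one] at h)
  have hs' : s⁻¹ * q⁻¹ ^ n = 1 := by rw [inv_pow, ← mul_inv, hs, inv_one]
  rw [← qSerre_inv q n (x + y), ← qSerre_inv q n y,
    qSerre_eq_serreIter (inv_ne_zero h0) hq' s⁻¹ n hs',
    qSerre_eq_serreIter (inv_ne_zero h0) hq' s⁻¹ n hs']
  have comm : ∀ m, serreIter (fun l => s⁻¹ * q⁻¹ ^ (2 * l + 1)) y z m * x =
      (s * q ^ (2 * m + 1)) • (x * serreIter (fun l => s⁻¹ * q⁻¹ ^ (2 * l + 1)) y z m) := by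
    intro m
    induction m with
    | zero => simpa [serreIter] using hzx
    | succ m ih =>
      rw [serreIter]
      set w := serreIter (fun l => s⁻¹ * q⁻¹ ^ (2 * l + 1)) y z m
      have h1 : y * w * x = (s * q ^ (2 * (m + 1) + 1)) • (x * (y * w)) := by
        rw [mul_assoc, ih, mul_smul_comm, ← mul_assoc y x w, hyx, smul_mul_assoc, smul_smul,
          mul_assoc x y w]
        congr 1
        ring
      have h2 : w * y * x = (s * q ^ (2 * (m + 1) + 1)) • (x * (w * y)) := by
        rw [mul_assoc, hyx, mul_smul_comm, ← mul_assoc w x y, ih, smul_mul_assoc, smul_smul,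
          mul_assoc x w y]
        congr 1
        ring
      rw [sub_mul, smul_mul_assoc, h1, h2, mul_sub, mul_smul_comm, smul_sub, smul_comm]
  have main : ∀ m, serreIter (fun l => s⁻¹ * q⁻¹ ^ (2 * l + 1)) (x + y) z m =
      serreIter (fun l => s⁻¹ * q⁻¹ ^ (2 * l + 1)) y z m := by
    intro m
    induction m with
    | zero => rfl
    | succ m ih =>
      rw [serreIter, serreIter, ih, add_mul, mul_add, smul_add, comm m, smul_smul]
      have : s⁻¹ * q⁻¹ ^ (2 * m + 1) * (s * q ^ (2 * m + 1)) = 1 := by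
        rw [inv_pow, mul_mul_mul_comm, inv_mul_cancel₀ hs0,
          inv_mul_cancel₀ (pow_ne_zero _ h0), one_mul]
      rw [this, one_smul]
      abel
  exact main n

theorem qSerre_add_add {A : Type*} [Ring A] [Algebra ℂ A] {q : ℂ} (h0 : q ≠ 0)
    (hq : ∀ m : ℕ, 0 < m → q ^ (2 * m) ≠ 1) (s : ℂ) (n : ℕ) (hs : s * q ^ n = 1)
    (x y x' y' : A) (hyx : y * x = (q ^ 2) • (x * y)) (hyx' : y * x' = (s * q) • (x' * y))
    (hy'x : y' * x = (s * q) • (x * y')) :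
    qSerre q n (x + y) (x' + y') = qSerre q n x x' + qSerre q n y y' := by
  rw [← qSerre_add_left h0 hq s n hs x y x' hyx hyx',
    ← qSerre_add_right h0 hq s n hs x y y' hyx hy'x]
  simp only [qSerre, mul_add, add_mul, smul_add, Finset.sum_add_distrib]

theorem map_qSerre {A B : Type*} [Ring A] [Algebra ℂ A] [Ring B] [Algebra ℂ B] (f : A →ₐ[ℂ] B)
    (q : ℂ) (n : ℕ) (x z : A) : f (qSerre q n x z) = qSerre q n (f x) (f z) := by
  simp only [qSerre, map_sum, map_smul, map_mul, map_pow]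

theorem qSerre_tmul {A B : Type*} [Ring A] [Algebra ℂ A] [Ring B] [Algebra ℂ B]
    (q : ℂ) (n : ℕ) (x z : A) (g h : B) (hgh : g * h = h * g) :
    qSerre q n (x ⊗ₜ[ℂ] g) (z ⊗ₜ[ℂ] h) = qSerre q n x z ⊗ₜ[ℂ] (g ^ n * h) := by
  simp only [qSerre, TensorProduct.sum_tmul]
  refine Finset.sum_congr rfl fun k hk => ?_
  have hk' : k ≤ n := Nat.lt_succ_iff.mp (Finset.mem_range.mp hk)
  have hc : Commute h (g ^ k) := (show Commute h g from hgh.symm).pow_right k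
  rw [Algebra.TensorProduct.tmul_pow, Algebra.TensorProduct.tmul_pow,
    Algebra.TensorProduct.tmul_mul_tmul, Algebra.TensorProduct.tmul_mul_tmul,
    TensorProduct.smul_tmul', mul_assoc (g ^ (n - k)), hc.eq, ← mul_assoc (g ^ (n - k)), ← pow_add,
    Nat.sub_add_cancel hk']

theorem qSerre_tmul' {A B : Type*} [Ring A] [Algebra ℂ A] [Ring B] [Algebra ℂ B]
    (q : ℂ) (n : ℕ) (x z : A) (g h : B) (hgh : g * h = h * g) :
    qSerre q n (g ⊗ₜ[ℂ] x) (h ⊗ₜ[ℂ] z) = (g ^ n * h) ⊗ₜ[ℂ] qSerre q n x z := by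
  simp only [qSerre, TensorProduct.tmul_sum]
  refine Finset.sum_congr rfl fun k hk => ?_
  have hk' : k ≤ n := Nat.lt_succ_iff.mp (Finset.mem_range.mp hk)
  have hc : Commute h (g ^ k) := (show Commute h g from hgh.symm).pow_right k
  rw [Algebra.TensorProduct.tmul_pow, Algebra.TensorProduct.tmul_pow,
    Algebra.TensorProduct.tmul_mul_tmul, Algebra.TensorProduct.tmul_mul_tmul,
    TensorProduct.tmul_smul, mul_assoc (g ^ (n - k)), hc.eq, ← mul_assoc (g ^ (n - k)), ← pow_add,
    Nat.sub_add_cancel hk']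

end QuantumNumbers

/-! ### The invariant form, the weight lattice and the algebra `U_q(g)` -/

section QuantumGroup

open LieAlgebra LieAlgebra.IsKilling Module

variable {g : Type u} [LieRing g] [LieAlgebra ℂ g] [FiniteDimensional ℂ g] [IsKilling ℂ g]
  {H : LieSubalgebra ℂ g} [H.IsCartanSubalgebra]

/-- The bilinear form on `h^*` that corresponds to the Killing form under the identification
`h ≃ h^*` given by the Killing form. -/
def dualKilling (H : LieSubalgebra ℂ g) [H.IsCartanSubalgebra] (lam mu : Dual ℂ H) : ℂ :=
  killingForm ℂ g ((cartanEquivDual H).symm lam : H) ((cartanEquivDual H).symm mu : H)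

/-- `B` is a symmetric bilinear form on `h^*` obtained from the (dual) Killing form by rescaling by
positive real numbers, constant along each simple ideal of `g`: by symmetry of `B` and of the
Killing form, `scale` takes the same value at non-orthogonal roots. -/
def IsRescaledKillingForm (B : LinearMap.BilinForm ℂ (Dual ℂ H)) : Prop :=
  B.IsSymm ∧ ∃ scale : H.root → ℝ, (∀ α, 0 < scale α) ∧
    ∀ α β : H.root, B ((rootSystem H).root α) ((rootSystem H).root β) =
      scale α * dualKilling H ((rootSystem H).root α) ((rootSystem H).root β)

variable (b : (rootSystem H).Base)

/-- The weight lattice `P`, spanned by the fundamental weights: the linear forms on `h` taking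
integral values at the simple coroots. -/
def weightLattice : AddSubgroup (Dual ℂ H) where
  carrier := {lam | ∀ i : b.support, ∃ n : ℤ, lam ((rootSystem H).coroot i) = n}
  zero_mem' := fun _ => ⟨0, by simp⟩
  add_mem' := fun {x y} hx hy i => by
    obtain ⟨m, hm⟩ := hx i
    obtain ⟨n, hn⟩ := hy i
    exact ⟨m + n, by rw [LinearMap.add_apply, hm, hn, Int.cast_add]⟩
  neg_mem' := fun {x} hx i => by
    obtain ⟨m, hm⟩ := hx i
    exact ⟨-m, by rw [LinearMap.neg_apply, hm, Int.cast_neg]⟩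

/-- The entry `a_ij = ⟨α_j, α_i^∨⟩ = 2 (α_i, α_j) / (α_i, α_i)` of the Cartan matrix. -/
def cartanEntry (i j : b.support) : ℤ := (rootSystem H).pairingIn ℤ j i

theorem root_apply_coroot_eq (i j : b.support) :
    ((rootSystem H).root j) ((rootSystem H).coroot i) = (cartanEntry b i j : ℂ) := by
  have h1 := (rootSystem H).algebraMap_pairingIn ℤ j i
  rw [eq_intCast] at h1
  exact h1.symm

/-- The simple root `α_i` as an element of the weight lattice. -/
def simpleRoot (i : b.support) : weightLattice b :=
  ⟨(rootSystem H).root i, fun j => ⟨cartanEntry b j i, root_apply_coroot_eq b j i⟩⟩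

/-- `q ^ z = e ^ (h z)` for `q = e ^ h`. -/
def qPow (h : ℝ) (z : ℂ) : ℂ := Complex.exp (h * z)

variable (B : LinearMap.BilinForm ℂ (Dual ℂ H)) (h : ℝ)

/-- `q_i = q ^ (d_i)`, where `d_i = (α_i, α_i) / 2`. -/
def qRoot (i : b.support) : ℂ :=
  qPow h (B ((rootSystem H).root i) ((rootSystem H).root i) / 2)

/-- The symbols for the generators of `U_q(g)`. -/
inductive UqGen : Type u
  | K (mu : weightLattice b) : UqGen
  | E (i : b.support) : UqGen
  | F (i : b.support) : UqGen

namespace UqGen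

/-- The generator `K_μ` of the free algebra. -/
def freeK (mu : weightLattice b) : FreeAlgebra ℂ (UqGen b) := FreeAlgebra.ι ℂ (UqGen.K mu)

/-- The generator `E_i` of the free algebra. -/
def freeE (i : b.support) : FreeAlgebra ℂ (UqGen b) := FreeAlgebra.ι ℂ (UqGen.E i)

/-- The generator `F_i` of the free algebra. -/
def freeF (i : b.support) : FreeAlgebra ℂ (UqGen b) := FreeAlgebra.ι ℂ (UqGen.F i)

end UqGen

open UqGen in
/-- The defining relations of `U_q(g)`, with `q = e ^ h`. -/
inductive UqRel : FreeAlgebra ℂ (UqGen b) → FreeAlgebra ℂ (UqGen b) → Prop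
  | K_zero : UqRel (freeK b 0) 1
  | K_mul (lam mu : weightLattice b) : UqRel (freeK b lam * freeK b mu) (freeK b (lam + mu))
  | K_E (lam : weightLattice b) (j : b.support) :
      UqRel (freeK b lam * freeE b j * freeK b (-lam))
        (qPow h (B lam (simpleRoot b j)) • freeE b j)
  | K_F (lam : weightLattice b) (j : b.support) :
      UqRel (freeK b lam * freeF b j * freeK b (-lam))
        (qPow h (-B lam (simpleRoot b j)) • freeF b j)
  | E_F_same (i : b.support) :
      UqRel (freeE b i * freeF b i - freeF b i * freeE b i)
        ((qRoot b B h i - (qRoot b B h i)⁻¹)⁻¹ •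
          (freeK b (simpleRoot b i) - freeK b (-simpleRoot b i)))
  | E_F_ne (i j : b.support) (hij : i ≠ j) :
      UqRel (freeE b i * freeF b j - freeF b j * freeE b i) 0
  | serre_E (i j : b.support) (hij : i ≠ j) :
      UqRel (qSerre (qRoot b B h i) (1 - cartanEntry b i j).toNat (freeE b i) (freeE b j)) 0
  | serre_F (i j : b.support) (hij : i ≠ j) :
      UqRel (qSerre (qRoot b B h i) (1 - cartanEntry b i j).toNat (freeF b i) (freeF b j)) 0

/-- The quantized universal enveloping algebra `U_q(g)` with `q = e ^ h`. -/
abbrev Uq : Type u := RingQuot (UqRel b B h)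

/-- The element `K_μ` of `U_q(g)`. -/
def uqK (mu : weightLattice b) : Uq b B h := RingQuot.mkAlgHom ℂ (UqRel b B h) (UqGen.freeK b mu)

/-- The element `E_i` of `U_q(g)`. -/
def uqE (i : b.support) : Uq b B h := RingQuot.mkAlgHom ℂ (UqRel b B h) (UqGen.freeE b i)

/-- The element `F_i` of `U_q(g)`. -/
def uqF (i : b.support) : Uq b B h := RingQuot.mkAlgHom ℂ (UqRel b B h) (UqGen.freeF b i)

/-- The values of the comultiplication of `U_q(g)` on generators. -/
def comulGen : UqGen b → Uq b B h ⊗[ℂ] Uq b B h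
  | .K mu => uqK b B h mu ⊗ₜ uqK b B h mu
  | .E i => uqE b B h i ⊗ₜ uqK b B h (simpleRoot b i) + 1 ⊗ₜ uqE b B h i
  | .F i => uqF b B h i ⊗ₜ 1 + uqK b B h (-simpleRoot b i) ⊗ₜ uqF b B h i

section relations

theorem uqK_zero : uqK b B h 0 = 1 := by
  simpa [uqK, uqE, uqF] using RingQuot.mkAlgHom_rel ℂ (UqRel.K_zero (b := b) (B := B) (h := h))

theorem uqK_mul (lam mu : weightLattice b) :
    uqK b B h lam * uqK b B h mu = uqK b B h (lam + mu) := by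
  simpa [uqK, uqE, uqF] using RingQuot.mkAlgHom_rel ℂ (UqRel.K_mul (b := b) (B := B) (h := h) lam mu)

theorem uqK_E (lam : weightLattice b) (j : b.support) :
    uqK b B h lam * uqE b B h j * uqK b B h (-lam) =
      qPow h (B lam (simpleRoot b j)) • uqE b B h j := by
  simpa [uqK, uqE, uqF] using RingQuot.mkAlgHom_rel ℂ (UqRel.K_E (b := b) (B := B) (h := h) lam j)

theorem uqK_F (lam : weightLattice b) (j : b.support) :
    uqK b B h lam * uqF b B h j * uqK b B h (-lam) =
      qPow h (-B lam (simpleRoot b j)) • uqF b B h j := by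
  simpa [uqK, uqE, uqF] using RingQuot.mkAlgHom_rel ℂ (UqRel.K_F (b := b) (B := B) (h := h) lam j)

theorem uqE_F_same (i : b.support) :
    uqE b B h i * uqF b B h i - uqF b B h i * uqE b B h i =
      (qRoot b B h i - (qRoot b B h i)⁻¹)⁻¹ •
        (uqK b B h (simpleRoot b i) - uqK b B h (-simpleRoot b i)) := by
  simpa [uqK, uqE, uqF] using RingQuot.mkAlgHom_rel ℂ (UqRel.E_F_same (b := b) (B := B) (h := h) i)

theorem uqE_F_ne (i j : b.support) (hij : i ≠ j) :
    uqE b B h i * uqF b B h j - uqF b B h j * uqE b B h i = 0 := by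
  simpa [uqK, uqE, uqF] using RingQuot.mkAlgHom_rel ℂ (UqRel.E_F_ne (b := b) (B := B) (h := h) i j hij)

theorem uq_serre_E (i j : b.support) (hij : i ≠ j) :
    qSerre (qRoot b B h i) (1 - cartanEntry b i j).toNat (uqE b B h i) (uqE b B h j) = 0 := by
  have := RingQuot.mkAlgHom_rel ℂ (UqRel.serre_E (b := b) (B := B) (h := h) i j hij)
  rwa [map_qSerre, map_zero] at this

theorem uq_serre_F (i j : b.support) (hij : i ≠ j) :
    qSerre (qRoot b B h i) (1 - cartanEntry b i j).toNat (uqF b B h i) (uqF b B h j) = 0 := by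
  have := RingQuot.mkAlgHom_rel ℂ (UqRel.serre_F (b := b) (B := B) (h := h) i j hij)
  rwa [map_qSerre, map_zero] at this

end relations

section scalars

theorem qPow_add (x y : ℂ) : qPow h (x + y) = qPow h x * qPow h y := by
  simp [qPow, mul_add, Complex.exp_add]

theorem qPow_ne_zero (x : ℂ) : qPow h x ≠ 0 := Complex.exp_ne_zero _

theorem qRoot_ne_zero (i : b.support) : qRoot b B h i ≠ 0 := qPow_ne_zero h _

theorem qPow_pow (x : ℂ) (n : ℕ) : qPow h x ^ n = qPow h (n * x) := by
  rw [qPow, qPow, ← Complex.exp_nat_mul]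
  congr 1
  ring

theorem dualKilling_eq (lam mu : Dual ℂ H) :
    dualKilling H lam mu = lam ((cartanEquivDual H).symm mu) := by
  have h1 := cartanEquivDual_apply_apply H ((cartanEquivDual H).symm lam)
    ((cartanEquivDual H).symm mu)
  rw [LinearEquiv.apply_symm_apply] at h1
  rw [h1]
  rfl

theorem dualKilling_comm (lam mu : Dual ℂ H) : dualKilling H lam mu = dualKilling H mu lam :=
  LieModule.traceForm_comm ℂ g g _ _

theorem apply_coroot_mul (lam : Dual ℂ H) (i : H.root) :
    2 * lam ((cartanEquivDual H).symm ((rootSystem H).root i)) = lam ((rootSystem H).coroot i) *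
      dualKilling H ((rootSystem H).root i) ((rootSystem H).root i) := by
  have hne : ((rootSystem H).root i)
      ((cartanEquivDual H).symm ((rootSystem H).root i)) ≠ 0 :=
    root_apply_cartanEquivDual_symm_ne_zero (LieSubalgebra.isNonZero_coe_root i)
  have hc : (rootSystem H).coroot i = (2 : ℕ) • (((rootSystem H).root i)
      ((cartanEquivDual H).symm ((rootSystem H).root i)))⁻¹ •
        (cartanEquivDual H).symm ((rootSystem H).root i) := rfl
  rw [dualKilling_eq, hc, map_nsmul, map_smul, smul_eq_mul, nsmul_eq_mul, Nat.cast_ofNat]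
  field_simp

theorem dualKilling_root_mul (i j : b.support) :
    2 * dualKilling H ((rootSystem H).root i) ((rootSystem H).root j) = cartanEntry b i j *
      dualKilling H ((rootSystem H).root i) ((rootSystem H).root i) := by
  rw [← root_apply_coroot_eq, dualKilling_comm, dualKilling_eq, apply_coroot_mul]

theorem dualKilling_root_self_pos (i : H.root) : ∃ r : ℝ, 0 < r ∧
    dualKilling H ((rootSystem H).root i) ((rootSystem H).root i) = r := by
  obtain ⟨k, hk⟩ : ∃ k, k = dualKilling H ((rootSystem H).root i) ((rootSystem H).root i) :=
    ⟨_, rfl⟩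
  have hk0 : k ≠ 0 := by
    rw [hk, dualKilling_eq]
    exact root_apply_cartanEquivDual_symm_ne_zero (LieSubalgebra.isNonZero_coe_root i)
  obtain ⟨t, ht⟩ : ∃ t : H, t = (cartanEquivDual H).symm ((rootSystem H).root i) := ⟨_, rfl⟩
  have hint : ∀ β : H.root, ∃ n : ℤ, 2 * ((rootSystem H).root β) t = n * k := fun β =>
    ⟨(rootSystem H).pairingIn ℤ β i, by
      have h1 := (rootSystem H).algebraMap_pairingIn ℤ β i
      rw [eq_intCast] at h1
      rw [ht, apply_coroot_mul, ← hk, h1]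
      rfl⟩
  choose n hn using hint
  have hsum : k = ∑ β : H.root, (((rootSystem H).root β) t) ^ 2 := by
    have h1 : k = ((killingForm ℂ g).restrict H) t t := by rw [hk, ht]; rfl
    rw [h1, restrict_killingForm_eq_sum, LinearMap.sum_apply, LinearMap.sum_apply,
      ← Finset.sum_coe_sort]
    refine Finset.sum_congr rfl fun β _ => ?_
    rw [sq]
    rfl
  have hS : k * (∑ β : H.root, (n β : ℝ) ^ 2 : ℝ) = 4 := by
    have h2 : 4 * k = k * (k * (∑ β : H.root, (n β : ℝ) ^ 2 : ℝ)) := by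
      conv_lhs => rw [hsum]
      push_cast
      rw [Finset.mul_sum, Finset.mul_sum, Finset.mul_sum]
      refine Finset.sum_congr rfl fun β _ => ?_
      linear_combination (2 * ((rootSystem H).root β) t + n β * k) * hn β
    exact mul_left_cancel₀ hk0 (by rw [← h2, mul_comm])
  have hS0 : (∑ β : H.root, (n β : ℝ) ^ 2 : ℝ) ≠ 0 := by
    intro h0
    rw [h0] at hS
    norm_num at hS
  have hSpos : (0 : ℝ) < ∑ β : H.root, (n β : ℝ) ^ 2 :=
    lt_of_le_of_ne (Finset.sum_nonneg fun β _ => sq_nonneg _) (Ne.symm hS0)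
  refine ⟨4 / ∑ β : H.root, (n β : ℝ) ^ 2, by positivity, ?_⟩
  rw [← hk, Complex.ofReal_div, eq_div_iff (Complex.ofReal_ne_zero.mpr hS0), hS]
  norm_num

variable {B} {h}

theorem form_root_mul (hB : IsRescaledKillingForm B) (i j : b.support) :
    2 * B ((rootSystem H).root i) ((rootSystem H).root j) = cartanEntry b i j *
      B ((rootSystem H).root i) ((rootSystem H).root i) := by
  obtain ⟨_, c, _, hc⟩ := hB
  rw [hc, hc, mul_left_comm, dualKilling_root_mul]
  ring

theorem form_root_self_pos (hB : IsRescaledKillingForm B) (i : H.root) : ∃ r : ℝ, 0 < r ∧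
    B ((rootSystem H).root i) ((rootSystem H).root i) = r := by
  obtain ⟨_, c, hc0, hc⟩ := hB
  obtain ⟨r, hr, hk⟩ := dualKilling_root_self_pos i
  exact ⟨c i * r, mul_pos (hc0 i) hr, by rw [hc, hk, Complex.ofReal_mul]⟩

theorem qRoot_pow_ne_one (hB : IsRescaledKillingForm B) (hh : h ≠ 0) (i : b.support) (m : ℕ)
    (hm : 0 < m) : qRoot b B h i ^ (2 * m) ≠ 1 := by
  obtain ⟨r, hr, hk⟩ := form_root_self_pos hB i.1
  rw [qRoot, qPow_pow, hk, qPow]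
  intro hone
  have h1 : (h : ℂ) * (((2 * m : ℕ) : ℂ) * (r / 2)) = ((h * (m * r) : ℝ) : ℂ) := by
    push_cast
    ring
  rw [h1, ← Complex.ofReal_exp, Complex.ofReal_eq_one, Real.exp_eq_one_iff] at hone
  have hm' : (0 : ℝ) < m := Nat.cast_pos.mpr hm
  exact mul_ne_zero hh (mul_pos hm' hr).ne' hone

theorem qRoot_sq (i : b.support) :
    qRoot b B h i ^ 2 = qPow h (B ((rootSystem H).root i) ((rootSystem H).root i)) := by
  rw [qRoot, qPow_pow]
  congr 1
  push_cast
  ring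

/-- The scalar `s = q_i ^ (a_ij - 1)`, used to apply the Serre identities. -/
theorem exists_serre_scalar (hB : IsRescaledKillingForm B) (i j : b.support) (hij : i ≠ j) :
    ∃ s : ℂ, s * qRoot b B h i ^ (1 - cartanEntry b i j).toNat = 1 ∧
      s * qRoot b B h i = qPow h (B ((rootSystem H).root i) ((rootSystem H).root j)) := by
  have ha : cartanEntry b i j ≤ 0 :=
    b.pairingIn_le_zero_of_ne (fun e => hij (Subtype.ext e.symm)) j.2 i.2
  have hn : (((1 - cartanEntry b i j).toNat : ℕ) : ℂ) = 1 - cartanEntry b i j := by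
    have : (((1 - cartanEntry b i j).toNat : ℕ) : ℤ) = 1 - cartanEntry b i j :=
      Int.toNat_of_nonneg (by omega)
    exact_mod_cast congrArg (Int.cast : ℤ → ℂ) this
  refine ⟨qPow h ((cartanEntry b i j - 1) *
    (B ((rootSystem H).root i) ((rootSystem H).root i) / 2)), ?_, ?_⟩
  · rw [qRoot, qPow_pow, ← qPow_add, hn, ← add_mul]
    simp [qPow]
  · rw [qRoot, ← qPow_add]
    congr 1
    linear_combination (-1 / 2 : ℂ) * form_root_mul b hB i j

end scalars

section comultiplication

variable {b} {B} {h}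

theorem uqK_mul_neg (lam : weightLattice b) : uqK b B h lam * uqK b B h (-lam) = 1 := by
  rw [uqK_mul, add_neg_cancel, uqK_zero]

theorem uqK_neg_mul (lam : weightLattice b) : uqK b B h (-lam) * uqK b B h lam = 1 := by
  rw [uqK_mul, neg_add_cancel, uqK_zero]

theorem uqK_comm (lam mu : weightLattice b) :
    uqK b B h lam * uqK b B h mu = uqK b B h mu * uqK b B h lam := by
  rw [uqK_mul, uqK_mul, add_comm]

theorem uqK_mul_uqE (lam : weightLattice b) (j : b.support) :
    uqK b B h lam * uqE b B h j =
      qPow h (B lam (simpleRoot b j)) • (uqE b B h j * uqK b B h lam) := by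
  rw [← smul_mul_assoc, ← uqK_E, mul_assoc _ (uqK b B h (-lam)), uqK_neg_mul, mul_one]

theorem uqK_mul_uqF (lam : weightLattice b) (j : b.support) :
    uqK b B h lam * uqF b B h j =
      qPow h (-B lam (simpleRoot b j)) • (uqF b B h j * uqK b B h lam) := by
  rw [← smul_mul_assoc, ← uqK_F, mul_assoc _ (uqK b B h (-lam)), uqK_neg_mul, mul_one]

/-- The mixed terms in the comultiplication of `[E_i, F_j]` cancel. -/
theorem comul_mixed (hB : IsRescaledKillingForm B) (i j : b.support) :
    (uqE b B h i * uqK b B h (-simpleRoot b j)) ⊗ₜ[ℂ]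
        (uqK b B h (simpleRoot b i) * uqF b B h j) =
      (uqK b B h (-simpleRoot b j) * uqE b B h i) ⊗ₜ[ℂ]
        (uqF b B h j * uqK b B h (simpleRoot b i)) := by
  rw [uqK_mul_uqF, uqK_mul_uqE, TensorProduct.tmul_smul, TensorProduct.smul_tmul']
  congr 3
  rw [NegMemClass.coe_neg, map_neg, LinearMap.neg_apply, hB.1.eq]

theorem comul_commutator (hB : IsRescaledKillingForm B) (i j : b.support) :
    comulGen b B h (.E i) * comulGen b B h (.F j) - comulGen b B h (.F j) * comulGen b B h (.E i) =
      (uqE b B h i * uqF b B h j - uqF b B h j * uqE b B h i) ⊗ₜ[ℂ] uqK b B h (simpleRoot b i) +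
      uqK b B h (-simpleRoot b j) ⊗ₜ[ℂ] (uqE b B h i * uqF b B h j - uqF b B h j * uqE b B h i) := by
  simp only [comulGen, mul_add, add_mul, Algebra.TensorProduct.tmul_mul_tmul, one_mul, mul_one,
    TensorProduct.sub_tmul, TensorProduct.tmul_sub, comul_mixed hB]
  abel

theorem comul_serre_E (hB : IsRescaledKillingForm B) (hh : h ≠ 0) (i j : b.support) (hij : i ≠ j) :
    qSerre (qRoot b B h i) (1 - cartanEntry b i j).toNat (comulGen b B h (.E i))
      (comulGen b B h (.E j)) = 0 := by
  obtain ⟨s, hs, hsq⟩ := exists_serre_scalar (h := h) b hB i j hij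
  have key : ∀ k l : b.support,
      (uqE b B h k ⊗ₜ[ℂ] uqK b B h (simpleRoot b k)) * (1 ⊗ₜ[ℂ] uqE b B h l) =
        qPow h (B ((rootSystem H).root k) ((rootSystem H).root l)) •
          ((1 ⊗ₜ[ℂ] uqE b B h l) * (uqE b B h k ⊗ₜ[ℂ] uqK b B h (simpleRoot b k))) := by
    intro k l
    rw [Algebra.TensorProduct.tmul_mul_tmul, Algebra.TensorProduct.tmul_mul_tmul, uqK_mul_uqE,
      TensorProduct.tmul_smul, one_mul, mul_one]
    rfl
  have hsymm : B ((rootSystem H).root j) ((rootSystem H).root i) =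
      B ((rootSystem H).root i) ((rootSystem H).root j) := hB.1.eq _ _
  simp only [comulGen]
  rw [add_comm (uqE b B h i ⊗ₜ[ℂ] _), add_comm (uqE b B h j ⊗ₜ[ℂ] _),
    qSerre_add_add (qRoot_ne_zero b B h i) (fun m hm => qRoot_pow_ne_one b hB hh i m hm) s _ hs _ _ _ _
      (by rw [qRoot_sq, key]) (by rw [hsq, key]) (by rw [hsq, key, hsymm]),
    qSerre_tmul _ _ _ _ _ _ (uqK_comm _ _), qSerre_tmul' _ _ _ _ _ _ rfl, uq_serre_E b B h i j hij,
    TensorProduct.tmul_zero, TensorProduct.zero_tmul, add_zero]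

theorem comul_serre_F (hB : IsRescaledKillingForm B) (hh : h ≠ 0) (i j : b.support) (hij : i ≠ j) :
    qSerre (qRoot b B h i) (1 - cartanEntry b i j).toNat (comulGen b B h (.F i))
      (comulGen b B h (.F j)) = 0 := by
  obtain ⟨s, hs, hsq⟩ := exists_serre_scalar (h := h) b hB i j hij
  have key : ∀ k l : b.support,
      (uqK b B h (-simpleRoot b k) ⊗ₜ[ℂ] uqF b B h k) * (uqF b B h l ⊗ₜ[ℂ] 1) =
        qPow h (B ((rootSystem H).root k) ((rootSystem H).root l)) •
          ((uqF b B h l ⊗ₜ[ℂ] 1) * (uqK b B h (-simpleRoot b k) ⊗ₜ[ℂ] uqF b B h k)) := by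
    intro k l
    rw [Algebra.TensorProduct.tmul_mul_tmul, Algebra.TensorProduct.tmul_mul_tmul, uqK_mul_uqF,
      ← TensorProduct.smul_tmul', one_mul, mul_one, NegMemClass.coe_neg, map_neg,
      LinearMap.neg_apply, neg_neg]
    rfl
  have hsymm : B ((rootSystem H).root j) ((rootSystem H).root i) =
      B ((rootSystem H).root i) ((rootSystem H).root j) := hB.1.eq _ _
  simp only [comulGen]
  rw [qSerre_add_add (qRoot_ne_zero b B h i) (fun m hm => qRoot_pow_ne_one b hB hh i m hm) s _ hs _ _ _ _
      (by rw [qRoot_sq, key]) (by rw [hsq, key]) (by rw [hsq, key, hsymm]),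
    qSerre_tmul _ _ _ _ _ _ rfl, qSerre_tmul' _ _ _ _ _ _ (uqK_comm _ _), uq_serre_F b B h i j hij,
    TensorProduct.tmul_zero, TensorProduct.zero_tmul, add_zero]

theorem comulGen_rel (hB : IsRescaledKillingForm B) (hh : h ≠ 0) :
    ∀ ⦃x y : FreeAlgebra ℂ (UqGen b)⦄, UqRel b B h x y →
      FreeAlgebra.lift ℂ (comulGen b B h) x = FreeAlgebra.lift ℂ (comulGen b B h) y := by
  have hK : ∀ mu, FreeAlgebra.lift ℂ (comulGen b B h) (UqGen.freeK b mu) =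
      uqK b B h mu ⊗ₜ uqK b B h mu := fun mu => FreeAlgebra.lift_ι_apply _ _
  have hE : ∀ i, FreeAlgebra.lift ℂ (comulGen b B h) (UqGen.freeE b i) =
      comulGen b B h (.E i) := fun i => FreeAlgebra.lift_ι_apply _ _
  have hF : ∀ i, FreeAlgebra.lift ℂ (comulGen b B h) (UqGen.freeF b i) =
      comulGen b B h (.F i) := fun i => FreeAlgebra.lift_ι_apply _ _
  intro x y hxy
  induction hxy with
  | K_zero => rw [hK, uqK_zero, map_one, Algebra.TensorProduct.one_def]
  | K_mul lam mu =>
    rw [map_mul, hK, hK, hK, Algebra.TensorProduct.tmul_mul_tmul, uqK_mul]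
  | K_E lam j =>
    rw [map_mul, map_mul, map_smul, hK, hK, hE, comulGen]
    simp only [mul_add, add_mul, Algebra.TensorProduct.tmul_mul_tmul, mul_one, uqK_E, uqK_mul_neg,
      smul_add, TensorProduct.tmul_smul, TensorProduct.smul_tmul']
    rw [uqK_comm lam, mul_assoc, uqK_mul_neg, mul_one]
  | K_F lam j =>
    rw [map_mul, map_mul, map_smul, hK, hK, hF, comulGen]
    simp only [mul_add, add_mul, Algebra.TensorProduct.tmul_mul_tmul, mul_one, uqK_F, uqK_mul_neg,
      smul_add, TensorProduct.tmul_smul, TensorProduct.smul_tmul']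
    rw [uqK_comm lam, mul_assoc, uqK_mul_neg, mul_one]
  | E_F_same i =>
    rw [map_sub, map_mul, map_mul, map_smul, map_sub, hE, hF, hK, hK, comul_commutator hB,
      uqE_F_same]
    simp only [TensorProduct.tmul_smul, ← TensorProduct.smul_tmul', TensorProduct.tmul_sub,
      TensorProduct.sub_tmul, ← smul_add]
    congr 1
    abel
  | E_F_ne i j hij =>
    rw [map_sub, map_mul, map_mul, hE, hF, comul_commutator hB, uqE_F_ne b B h i j hij, map_zero,
      TensorProduct.tmul_zero, TensorProduct.zero_tmul, add_zero]
  | serre_E i j hij => 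
    refine (map_qSerre (FreeAlgebra.lift ℂ (comulGen b B h)) _ _ _ _).trans ?_
    rw [hE, hE, map_zero]
    exact comul_serre_E hB hh i j hij
  | serre_F i j hij => 
    refine (map_qSerre (FreeAlgebra.lift ℂ (comulGen b B h)) _ _ _ _).trans ?_
    rw [hF, hF, map_zero]
    exact comul_serre_F hB hh i j hij

/-- The comultiplication `U_q(g) → U_q(g) ⊗ U_q(g)`. -/
def uqComul (hB : IsRescaledKillingForm B) (hh : h ≠ 0) :
    Uq b B h →ₐ[ℂ] Uq b B h ⊗[ℂ] Uq b B h :=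
  RingQuot.liftAlgHom ℂ ⟨FreeAlgebra.lift ℂ (comulGen b B h), comulGen_rel hB hh⟩

theorem uqComul_uqK (hB : IsRescaledKillingForm B) (hh : h ≠ 0) (mu : weightLattice b) :
    uqComul hB hh (uqK b B h mu) = uqK b B h mu ⊗ₜ uqK b B h mu := by
  simp [uqComul, uqK, UqGen.freeK, comulGen]

theorem uqComul_uqE (hB : IsRescaledKillingForm B) (hh : h ≠ 0) (i : b.support) :
    uqComul hB hh (uqE b B h i) =
      uqE b B h i ⊗ₜ uqK b B h (simpleRoot b i) + 1 ⊗ₜ uqE b B h i := by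
  simp [uqComul, uqE, UqGen.freeE, comulGen]

theorem uqComul_uqF (hB : IsRescaledKillingForm B) (hh : h ≠ 0) (i : b.support) :
    uqComul hB hh (uqF b B h i) =
      uqF b B h i ⊗ₜ 1 + uqK b B h (-simpleRoot b i) ⊗ₜ uqF b B h i := by
  simp [uqComul, uqF, UqGen.freeF, comulGen]

end comultiplication

end QuantumGroup

/-! ### Conditions on modules

A left module over a complex algebra `A` is given by a complex vector space `V` together with an
algebra homomorphism `A →ₐ[ℂ] Module.End ℂ V`. -/

section Modules

variable {A : Type*} [Ring A] [Algebra ℂ A] {V : Type*} [AddCommGroup V] [Module ℂ V]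

/-- The module `V` is finitely generated over `A`. -/
def IsFinitelyGenerated (ρ : A →ₐ[ℂ] Module.End ℂ V) : Prop :=
  ∃ s : Finset V, Submodule.span ℂ {w : V | ∃ a : A, ∃ v ∈ s, w = ρ a v} = ⊤

/-- The subspace `S • v` of `V`, for a subalgebra `S` of `A` and a vector `v`. -/
def orbitSpace (S : Subalgebra ℂ A) (ρ : A →ₐ[ℂ] Module.End ℂ V) (v : V) : Submodule ℂ V :=
  S.toSubmodule.map ((LinearMap.applyₗ v : Module.End ℂ V →ₗ[ℂ] V) ∘ₗ ρ.toLinearMap)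

/-- For each `v`, the subspace `S • v` is finite dimensional. -/
def IsLocallyFinite (S : Subalgebra ℂ A) (ρ : A →ₐ[ℂ] Module.End ℂ V) : Prop :=
  ∀ v : V, FiniteDimensional ℂ (orbitSpace S ρ v)

end Modules

/-! ### The category `O` of `U_q(g)` -/

section QuantumCategoryO

open LieAlgebra LieAlgebra.IsKilling Module

variable {g : Type u} [LieRing g] [LieAlgebra ℂ g] [FiniteDimensional ℂ g] [IsKilling ℂ g]
  {H : LieSubalgebra ℂ g} [H.IsCartanSubalgebra] {b : (rootSystem H).Base}
  {B : LinearMap.BilinForm ℂ (Dual ℂ H)} {h : ℝ}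

/-- The subalgebra `U_q(n_+)` generated by the `E_i`. -/
def uqNPlus (b : (rootSystem H).Base) (B : LinearMap.BilinForm ℂ (Dual ℂ H)) (h : ℝ) :
    Subalgebra ℂ (Uq b B h) :=
  Algebra.adjoin ℂ (Set.range (uqE b B h))

/-- The weight space of weight `lam`: the vectors `v` with `K_μ v = q ^ (lam, μ) v` for all `μ` in
the weight lattice. It depends only on the character `μ ↦ q ^ (lam, μ)`, i.e. only on the class of
`lam` in the quotient `h_q^*` of `h^*` by the linear forms `lam` with `q ^ (lam, μ) = 1` for all `μ`
in the weight lattice. -/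
def uqWeightSpace {V : Type*} [AddCommGroup V] [Module ℂ V] (ρ : Uq b B h →ₐ[ℂ] Module.End ℂ V)
    (lam : Dual ℂ H) : Submodule ℂ V :=
  ⨅ mu : weightLattice b, Module.End.eigenspace (ρ (uqK b B h mu)) (qPow h (B lam mu))

/-- The module `V` belongs to the category `O` of `U_q(g)`. In `weight` the sum over the distinct
weight spaces is automatically direct, since these are the simultaneous eigenspaces of a family of
operators for pairwise distinct systems of eigenvalues. -/
structure IsInO {V : Type*} [AddCommGroup V] [Module ℂ V]
    (ρ : Uq b B h →ₐ[ℂ] Module.End ℂ V) : Prop where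
  finitelyGenerated : IsFinitelyGenerated ρ
  weight : ⨆ lam : Dual ℂ H, uqWeightSpace ρ lam = ⊤
  locallyFinite : IsLocallyFinite (uqNPlus b B h) ρ

/-- The tensor product of two `U_q(g)`-modules, with `U_q(g)` acting through the comultiplication. -/
def uqTensor (hB : IsRescaledKillingForm B) (hh : h ≠ 0)
    {V W : Type*} [AddCommGroup V] [Module ℂ V] [AddCommGroup W] [Module ℂ W]
    (ρ : Uq b B h →ₐ[ℂ] Module.End ℂ V) (σ : Uq b B h →ₐ[ℂ] Module.End ℂ W) :
    Uq b B h →ₐ[ℂ] Module.End ℂ (V ⊗[ℂ] W) :=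
  (Module.endTensorEndAlgHom (R := ℂ) (S := ℂ) (A := ℂ)).comp
    ((Algebra.TensorProduct.map ρ σ).comp (uqComul hB hh))

/-- The module `V` is tensor-closed: `V ⊗ W` is in `O` for every `W` in `O`. -/
def IsTensorClosed (hB : IsRescaledKillingForm B) (hh : h ≠ 0)
    {V : Type u} [AddCommGroup V] [Module ℂ V] (ρ : Uq b B h →ₐ[ℂ] Module.End ℂ V) : Prop :=
  ∀ (W : Type u) [AddCommGroup W] [Module ℂ W] (σ : Uq b B h →ₐ[ℂ] Module.End ℂ W),
    IsInO σ → IsInO (uqTensor hB hh ρ σ)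

end QuantumCategoryO

/-! ### The category `O` of `g` -/

section ClassicalCategoryO

open LieAlgebra LieAlgebra.IsKilling Module

variable {g : Type u} [LieRing g] [LieAlgebra ℂ g] [FiniteDimensional ℂ g] [IsKilling ℂ g]
  {H : LieSubalgebra ℂ g} [H.IsCartanSubalgebra]

/-- The action of the universal enveloping algebra `U(g)` on a module over `g`. -/
def lieAction (g : Type u) [LieRing g] [LieAlgebra ℂ g] (M : Type*) [AddCommGroup M] [Module ℂ M]
    [LieRingModule g M] [LieModule ℂ g M] :
    UniversalEnvelopingAlgebra ℂ g →ₐ[ℂ] Module.End ℂ M :=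
  UniversalEnvelopingAlgebra.lift ℂ (LieModule.toEnd ℂ g M)

/-- The subalgebra `U(n_+)` of `U(g)` generated by the root spaces of the positive roots. -/
def lieNPlus (b : (rootSystem H).Base) : Subalgebra ℂ (UniversalEnvelopingAlgebra ℂ g) :=
  Algebra.adjoin ℂ (UniversalEnvelopingAlgebra.ι ℂ ''
    {x : g | ∃ α : H.root, b.IsPos α ∧ x ∈ rootSpace H ((rootSystem H).root α)})

/-- The module `M` belongs to the BGG category `O` of `g`. -/
structure IsInLieO (b : (rootSystem H).Base) (M : Type*) [AddCommGroup M] [Module ℂ M]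
    [LieRingModule g M] [LieModule ℂ g M] : Prop where
  finitelyGenerated : IsFinitelyGenerated (lieAction g M)
  weight : ⨆ lam : Dual ℂ H, (LieModule.weightSpace M (lam : H → ℂ)).toSubmodule = ⊤
  locallyFinite : IsLocallyFinite (lieNPlus b) (lieAction g M)

/-- The module `M` is tensor-closed: `M ⊗ N` is in `O` for every `N` in `O`. -/
def IsLieTensorClosed (b : (rootSystem H).Base) (M : Type u) [AddCommGroup M] [Module ℂ M]
    [LieRingModule g M] [LieModule ℂ g M] : Prop :=
  ∀ (N : Type u) [AddCommGroup N] [Module ℂ N] [LieRingModule g N] [LieModule ℂ g N],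
    IsInLieO b N → IsInLieO b (M ⊗[ℂ] N)

end ClassicalCategoryO

end CategoryO

end

/-! The quantum and the classical statement are one argument about weight-graded spaces with raising
operators e_i and lowering operators f_i, axiomatised by `WeightDatum` and `WeightAction`. Objects
of either category carry this structure (`qAction`, `lieActionWeight`).

Suppose M ⊗ M lies in the category. In any object, weight multiplicities are bounded along each line
γ₀ + ℤα_i (`exists_string_bound`). Indeed the object is spanned by words in the f's applied to
finitely many homogeneous vectors. A word landing on the line has a bounded number of letters other
than f_i, and the Serre relations leave only boundedly many f_i to the right of such letters. So the
weight spaces on the line lie in the span of the vectors f_i^a t with t in a finite set, and each t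
contributes at most one vector per weight. But if f_i^n v ≠ 0 for all n, where v is a weight vector
of M, then for each C the C + 1 vectors f_i^a v ⊗ f_i^(C-a) v are independent and share a weight on
one fixed line. Hence every f_i is locally nilpotent on M (`exists_f_pow_eq_zero`).

By sl₂-theory the weights are then integral and stable under simple reflections
(`exists_reflection`). All weights lie below finitely many, which bounds their heights above. The
Weyl group is finite and its orbits sum to zero, so the heights are bounded below as well
(`exists_height_le`). Long words in the f's therefore kill the generators, and M is finite
dimensional.

Conversely, let V be finite dimensional. The products of a spanning set of V with generators of W
generate V ⊗ W, weights add, and V ⊗ U is a finite-dimensional stable subspace whenever U is a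
suitable finite-dimensional stable subspace of W. -/

namespace CategoryO

/-! ### Weight-graded spaces with raising and lowering operators -/

/-- The combinatorial data governing weights: simple roots `α i` in a group `Γ` of weights, the
scalar `φ i γ` by which `[e i, f i]` acts in weight `γ`, integers `A i j` and a relation `D i γ m`
expressing that the weight `γ` takes the value `m` on the `i`-th coroot. -/
structure WeightDatum (ι Γ : Type*) [AddCommGroup Γ] where
  α : ι → Γ
  φ : ι → Γ → ℂ
  A : ι → ι → ℤ
  D : ι → Γ → ℤ → Prop
  linInd : LinearIndependent ℤ α
  A_self : ∀ i, A i i = 2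
  -- The sum is the scalar in e_i f_i^(n+1) u = (scalar) f_i^n u for u of weight γ killed by e_i. It
  -- vanishes when f_i^(n+1) u = 0 ≠ f_i^n u, and integrality of weights comes from this.
  D_of_sum_eq_zero : ∀ i γ (n : ℕ), ∑ k ∈ Finset.range (n + 1), φ i (γ - k • α i) = 0 → D i γ n
  D_sub : ∀ i j γ m, D i γ m → D i (γ - α j) (m - A i j)
  D_add : ∀ i j γ m, D i γ m → D i (γ + α j) (m + A i j)
  D_unique : ∀ i γ m m', D i γ m → D i γ m' → m = m'

namespace WeightDatum

variable {ι Γ : Type*} [AddCommGroup Γ] (𝒟 : WeightDatum ι Γ)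

/-- The embedding of the root lattice into the group of weights. -/
noncomputable def rootHom : (ι →₀ ℤ) →ₗ[ℤ] Γ := Finsupp.linearCombination ℤ 𝒟.α

theorem rootHom_single (i : ι) (n : ℤ) : 𝒟.rootHom (Finsupp.single i n) = n • 𝒟.α i := by
  simp [rootHom]

theorem rootHom_injective : Function.Injective 𝒟.rootHom := 𝒟.linInd

theorem D_sub_rootHom (i : ι) (n : ι →₀ ℤ) : ∀ (γ : Γ) (m : ℤ), 𝒟.D i γ m →
    𝒟.D i (γ - 𝒟.rootHom n) (m - Finsupp.linearCombination ℤ (𝒟.A i) n) := by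
  induction n using Finsupp.induction_linear with
  | zero => simp
  | add x y hx hy =>
    intro γ m h
    rw [map_add, map_add, ← sub_sub, ← sub_sub]
    exact hy _ _ (hx _ _ h)
  | single j z =>
    intro γ m h
    rw [rootHom_single, Finsupp.linearCombination_single]
    induction z using Int.induction_on with
    | zero => simpa using h
    | succ k ih =>
      have := 𝒟.D_sub i j _ _ ih
      rw [add_smul, add_smul, one_smul, one_smul, ← sub_sub, ← sub_sub]
      exact this
    | pred k ih =>
      have := 𝒟.D_add i j _ _ ih
      rw [sub_smul, sub_smul, one_smul, one_smul, sub_sub_eq_add_sub, sub_sub_eq_add_sub,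
        add_sub_right_comm, add_sub_right_comm]
      exact this

/-- The content of a word in the simple roots. -/
noncomputable def content (w : List ι) : ι →₀ ℤ := (w.map fun i => Finsupp.single i 1).sum

@[simp] theorem content_nil : content ([] : List ι) = 0 := rfl

@[simp] theorem content_cons (i : ι) (w : List ι) :
    content (i :: w) = Finsupp.single i 1 + content w := by simp [content]

/-- The height of an element of the root lattice. -/
noncomputable def height : (ι →₀ ℤ) →ₗ[ℤ] ℤ := Finsupp.linearCombination ℤ fun _ => (1 : ℤ)

theorem height_content (w : List ι) : height (content w) = w.length := by
  induction w with
  | nil => simp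
  | cons i w ih =>
    rw [content_cons, map_add, ih, height, Finsupp.linearCombination_single]
    simp [add_comm]

open Classical in
/-- The height of an element of the root lattice, ignoring one simple root. -/
noncomputable def heightAway (i : ι) : (ι →₀ ℤ) →ₗ[ℤ] ℤ :=
  Finsupp.linearCombination ℤ fun j => if j = i then (0 : ℤ) else 1

end WeightDatum

open WeightDatum

/-- A weight-graded space with raising and lowering operators satisfying the properties shared by
the objects of the categories `O`. -/
structure WeightAction {ι Γ : Type*} [AddCommGroup Γ] (𝒟 : WeightDatum ι Γ) (M : Type*)
    [AddCommGroup M] [Module ℂ M] where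
  wt : Γ → Submodule ℂ M
  e : ι → Module.End ℂ M
  f : ι → Module.End ℂ M
  indep : iSupIndep wt
  iSup_wt : ⨆ γ, wt γ = ⊤
  e_mem : ∀ i γ x, x ∈ wt γ → e i x ∈ wt (γ + 𝒟.α i)
  f_mem : ∀ i γ x, x ∈ wt γ → f i x ∈ wt (γ - 𝒟.α i)
  comm_same : ∀ i γ x, x ∈ wt γ → e i (f i x) = f i (e i x) + 𝒟.φ i γ • x
  comm_ne : ∀ i j, i ≠ j → ∀ x, e i (f j x) = f j (e i x)
  eFinite : ∀ v, FiniteDimensional ℂ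
    (Submodule.span ℂ (Set.range fun w : List ι => (w.map e).prod v))
  -- Restricting to graded subspaces Y replaces stability under the torus, so the structure need not
  -- mention the K_μ or the Cartan subalgebra.
  fg : ∃ S : Finset M, ∀ Y : Submodule ℂ M, (S : Set M) ⊆ Y → (∀ i, ∀ y ∈ Y, e i y ∈ Y) →
    (∀ i, ∀ y ∈ Y, f i y ∈ Y) → Y ≤ ⨆ γ, Y ⊓ wt γ → Y = ⊤
  -- The only consequence of the Serre relations that is needed: N factors f_i to the right of f_j
  -- can be traded for fewer.
  serre : ∀ i j, i ≠ j → ∃ (N : ℕ) (c : ℕ → ℂ), ∀ x,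
    f j ((f i ^ N) x) = ∑ k ∈ Finset.range N, c k • (f i ^ (N - k)) (f j ((f i ^ k) x))

/-! ### Homogeneous vectors, words in the lowering operators, and finite sets of generators -/

namespace WeightAction

variable {ι Γ : Type*} [AddCommGroup Γ] {𝒟 : WeightDatum ι Γ} {M : Type*}
    [AddCommGroup M] [Module ℂ M] (𝒜 : WeightAction 𝒟 M)

theorem map_mem_of_mem_span {S : Set M} {P : Submodule ℂ M} (f : Module.End ℂ M)
    (h : ∀ x ∈ S, f x ∈ P) {y : M} (hy : y ∈ Submodule.span ℂ S) : f y ∈ P :=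
  (Submodule.span_le (p := P.comap f)).mpr h hy

/-- A homogeneous vector. -/
def IsHomogeneous (x : M) : Prop := ∃ γ, x ∈ 𝒜.wt γ

/-- Since the weight spaces are independent, the spanning vectors of other weights contribute zero
and can be discarded. -/
theorem mem_span_inter {T : Set M} (hT : ∀ t ∈ T, 𝒜.IsHomogeneous t) {γ : Γ} {x : M}
    (hx : x ∈ 𝒜.wt γ) (hxT : x ∈ Submodule.span ℂ T) :
    x ∈ Submodule.span ℂ (T ∩ 𝒜.wt γ) := by
  have hle : ∀ δ, Submodule.span ℂ (T ∩ 𝒜.wt δ) ≤ 𝒜.wt δ := fun δ =>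
    Submodule.span_le.mpr Set.inter_subset_right
  have h1 : Submodule.span ℂ T ≤ ⨆ δ, Submodule.span ℂ (T ∩ 𝒜.wt δ) := by
    refine Submodule.span_le.mpr fun t ht => ?_
    obtain ⟨δ, hδ⟩ := hT t ht
    exact Submodule.mem_iSup_of_mem δ (Submodule.subset_span ⟨ht, hδ⟩)
  have h2 := h1 hxT
  rw [iSup_split_single _ γ] at h2
  obtain ⟨y, hy, z, hz, rfl⟩ := Submodule.mem_sup.mp h2
  have hz0 : z = 0 := by
    refine (Submodule.disjoint_def.mp (𝒜.indep γ)) z ?_ ?_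
    · have := Submodule.sub_mem _ hx (hle γ hy)
      simpa using this
    · exact (iSup₂_mono fun δ _ => hle δ) hz
  rwa [hz0, add_zero]

theorem eq_of_mem_wt {γ δ : Γ} {x : M} (hx : x ≠ 0) (h1 : x ∈ 𝒜.wt γ) (h2 : x ∈ 𝒜.wt δ) :
    γ = δ := by
  by_contra hne
  exact hx (Submodule.disjoint_def.mp (𝒜.indep.pairwiseDisjoint hne) x h1 h2)

/-- The operator attached to a word in the lowering operators. -/
def fWord (w : List ι) : Module.End ℂ M := (w.map 𝒜.f).prod

@[simp] theorem fWord_nil (x : M) : 𝒜.fWord [] x = x := rfl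

@[simp] theorem fWord_cons (i : ι) (w : List ι) (x : M) :
    𝒜.fWord (i :: w) x = 𝒜.f i (𝒜.fWord w x) := by simp [fWord]

theorem fWord_mem {γ : Γ} {x : M} (hx : x ∈ 𝒜.wt γ) (w : List ι) :
    𝒜.fWord w x ∈ 𝒜.wt (γ - 𝒟.rootHom (content w)) := by
  induction w with
  | nil => simpa using hx
  | cons i w ih =>
    have := 𝒜.f_mem i _ _ ih
    rwa [sub_sub, add_comm, ← one_smul ℤ (𝒟.α i), ← rootHom_single, ← map_add, ← content_cons,
      ← fWord_cons] at this

theorem eWord_isHomogeneous {x : M} (hx : 𝒜.IsHomogeneous x) (w : List ι) :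
    𝒜.IsHomogeneous ((w.map 𝒜.e).prod x) := by
  induction w with
  | nil => simpa using hx
  | cons i w ih =>
    obtain ⟨γ, hγ⟩ := ih
    exact ⟨_, by simpa using 𝒜.e_mem i γ _ hγ⟩

theorem f_pow_mem (i : ι) {γ : Γ} {x : M} (hx : x ∈ 𝒜.wt γ) (n : ℕ) :
    (𝒜.f i ^ n) x ∈ 𝒜.wt (γ - n • 𝒟.α i) := by
  induction n with
  | zero => simpa using hx
  | succ n ih =>
    rw [pow_succ', Module.End.mul_apply, succ_nsmul, ← sub_sub]
    exact 𝒜.f_mem i _ _ ih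

theorem e_pow_mem (i : ι) {γ : Γ} {x : M} (hx : x ∈ 𝒜.wt γ) (n : ℕ) :
    (𝒜.e i ^ n) x ∈ 𝒜.wt (γ + n • 𝒟.α i) := by
  induction n with
  | zero => simpa using hx
  | succ n ih =>
    rw [pow_succ', Module.End.mul_apply, succ_nsmul, ← add_assoc]
    exact 𝒜.e_mem i _ _ ih

theorem exists_homogeneous_finset (x : M) :
    ∃ T : Finset M, (∀ t ∈ T, 𝒜.IsHomogeneous t) ∧ x ∈ Submodule.span ℂ (T : Set M) := by
  have hx : x ∈ Submodule.span ℂ {y | 𝒜.IsHomogeneous y} := by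
    have h1 : ⨆ γ, 𝒜.wt γ ≤ Submodule.span ℂ {y | 𝒜.IsHomogeneous y} :=
      iSup_le fun γ y hy => Submodule.subset_span ⟨γ, hy⟩
    exact h1 (𝒜.iSup_wt ▸ Submodule.mem_top)
  obtain ⟨T, hT, hxT⟩ := Submodule.mem_span_finite_of_mem_span hx
  exact ⟨T, hT, hxT⟩

theorem exists_eStable_finset {x : M} (hx : 𝒜.IsHomogeneous x) :
    ∃ T : Finset M, (∀ t ∈ T, 𝒜.IsHomogeneous t) ∧ x ∈ Submodule.span ℂ (T : Set M) ∧
      ∀ i, ∀ t ∈ T, 𝒜.e i t ∈ Submodule.span ℂ (T : Set M) := by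
  have h1 := 𝒜.eFinite x
  obtain ⟨T, hT, hs⟩ := (Submodule.fg_span_iff_fg_span_finset_subset _).mp
    ((Submodule.fg_iff_finiteDimensional _).mpr h1)
  refine ⟨T, fun t ht => ?_, ?_, fun i t ht => ?_⟩
  · obtain ⟨w, rfl⟩ := hT ht
    exact 𝒜.eWord_isHomogeneous hx w
  · rw [← hs]
    exact Submodule.subset_span ⟨[], rfl⟩
  · obtain ⟨w, rfl⟩ := hT ht
    rw [← hs]
    exact Submodule.subset_span ⟨i :: w, by simp⟩

/-- Every finite set is contained in a finite-dimensional graded subspace that is stable under the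
raising operators. -/
theorem exists_eStable_of_finset (S : Finset M) : ∃ T : Finset M, (∀ t ∈ T, 𝒜.IsHomogeneous t) ∧
    (S : Set M) ⊆ Submodule.span ℂ (T : Set M) ∧
      ∀ i, ∀ t ∈ T, 𝒜.e i t ∈ Submodule.span ℂ (T : Set M) := by
  classical
  choose T₀ hT₀ hST₀ using 𝒜.exists_homogeneous_finset
  choose T₁ hT₁ hmem hstab using fun x : {x // 𝒜.IsHomogeneous x} => 𝒜.exists_eStable_finset x.2
  let T : Finset M := S.biUnion fun s => (T₀ s).attach.biUnion fun x => T₁ ⟨x, hT₀ s x x.2⟩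
  have hTsub : ∀ s ∈ S, ∀ x (hx : x ∈ T₀ s), T₁ ⟨x, hT₀ s x hx⟩ ⊆ T := by
    intro s hs x hx t ht
    simp only [T, Finset.mem_biUnion]
    exact ⟨s, hs, ⟨x, hx⟩, Finset.mem_attach _ _, ht⟩
  have hThom : ∀ t ∈ T, 𝒜.IsHomogeneous t := by
    intro t ht
    simp only [T, Finset.mem_biUnion] at ht
    obtain ⟨s, hs, x, -, ht⟩ := ht
    exact hT₁ _ t ht
  have hTe : ∀ i, ∀ t ∈ T, 𝒜.e i t ∈ Submodule.span ℂ (T : Set M) := by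
    intro i t ht
    simp only [T, Finset.mem_biUnion] at ht
    obtain ⟨s, hs, x, -, ht⟩ := ht
    exact Submodule.span_mono (Finset.coe_subset.mpr (hTsub s hs x x.2)) (hstab _ i t ht)
  have hTS : (S : Set M) ⊆ Submodule.span ℂ (T : Set M) := by
    intro s hs
    refine Submodule.span_le.mpr ?_ (hST₀ s)
    intro x hx
    exact Submodule.span_mono (Finset.coe_subset.mpr (hTsub s hs x hx)) (hmem ⟨x, hT₀ s x hx⟩)
  exact ⟨T, hThom, hTS, hTe⟩

/-- A substitute for the triangular decomposition. Enlarge the generators to a finite homogeneous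
set whose span is stable under the e_i. Moving e_i past a word in the f's then costs only scalars,
so the span of all f-words on this set is stable under every operator. -/
theorem exists_generators : ∃ T : Finset M, (∀ t ∈ T, 𝒜.IsHomogeneous t) ∧
    Submodule.span ℂ {x | ∃ t ∈ T, ∃ w, x = 𝒜.fWord w t} = ⊤ := by
  obtain ⟨S, hS⟩ := 𝒜.fg
  obtain ⟨T, hThom, hTS, hTe⟩ := 𝒜.exists_eStable_of_finset S
  refine ⟨T, hThom, hS _ ?_ ?_ ?_ ?_⟩
  · refine hTS.trans (SetLike.coe_subset_coe.mpr (Submodule.span_mono fun t ht => ⟨t, ht, [], rfl⟩))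
  · intro i y hy
    suffices ∀ w, ∀ t ∈ T, 𝒜.e i (𝒜.fWord w t) ∈
        Submodule.span ℂ {x | ∃ t ∈ T, ∃ w, x = 𝒜.fWord w t} by
      refine map_mem_of_mem_span (𝒜.e i) ?_ hy
      rintro _ ⟨t, ht, w, rfl⟩
      exact this w t ht
    have hf : ∀ j y, y ∈ Submodule.span ℂ {x | ∃ t ∈ T, ∃ w, x = 𝒜.fWord w t} →
        𝒜.f j y ∈ Submodule.span ℂ {x | ∃ t ∈ T, ∃ w, x = 𝒜.fWord w t} := by
      intro j y hy
      refine map_mem_of_mem_span (𝒜.f j) ?_ hy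
      rintro _ ⟨t, ht, w, rfl⟩
      exact Submodule.subset_span ⟨t, ht, j :: w, by simp⟩
    intro w
    induction w with
    | nil =>
      intro t ht
      rw [fWord_nil]
      refine Submodule.span_mono ?_ (hTe i t ht)
      exact fun t ht => ⟨t, ht, [], rfl⟩
    | cons j w ih =>
      intro t ht
      rw [fWord_cons]
      by_cases hij : i = j
      · subst hij
        obtain ⟨γ, hγ⟩ := hThom t ht
        rw [𝒜.comm_same i _ _ (𝒜.fWord_mem hγ w)]
        exact Submodule.add_mem _ (hf _ _ (ih t ht))
          (Submodule.smul_mem _ _ (Submodule.subset_span ⟨t, ht, w, rfl⟩))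
      · rw [𝒜.comm_ne i j hij]
        exact hf _ _ (ih t ht)
  · intro j y hy
    refine map_mem_of_mem_span (𝒜.f j) ?_ hy
    rintro _ ⟨t, ht, w, rfl⟩
    exact Submodule.subset_span ⟨t, ht, j :: w, by simp⟩
  · refine Submodule.span_le.mpr ?_
    rintro _ ⟨t, ht, w, rfl⟩
    obtain ⟨γ, hγ⟩ := hThom t ht
    exact Submodule.mem_iSup_of_mem _
      ⟨Submodule.subset_span ⟨t, ht, w, rfl⟩, 𝒜.fWord_mem hγ w⟩

/-! #### Weight multiplicities along strings -/

/-- The span of the vectors `f i ^ a t` with `t ∈ T`. -/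
def strip (i : ι) (T : Set M) : Submodule ℂ M :=
  Submodule.span ℂ {x | ∃ a : ℕ, ∃ t ∈ T, x = (𝒜.f i ^ a) t}

theorem strip_mono (i : ι) {T T' : Set M} (h : T ⊆ T') : 𝒜.strip i T ≤ 𝒜.strip i T' :=
  Submodule.span_mono fun _ ⟨a, t, ht, hx⟩ => ⟨a, t, h ht, hx⟩

theorem subset_strip (i : ι) {T : Set M} {t : M} (ht : t ∈ T) : t ∈ 𝒜.strip i T :=
  Submodule.subset_span ⟨0, t, ht, rfl⟩

theorem f_mem_strip (i : ι) {T : Set M} {x : M} (hx : x ∈ 𝒜.strip i T) :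
    𝒜.f i x ∈ 𝒜.strip i T := by
  refine map_mem_of_mem_span (𝒜.f i) ?_ hx
  rintro _ ⟨a, t, ht, rfl⟩
  exact Submodule.subset_span ⟨a + 1, t, ht, by rw [pow_succ', Module.End.mul_apply]⟩

theorem f_pow_mem_strip (i : ι) {T : Set M} {x : M} (hx : x ∈ 𝒜.strip i T) (n : ℕ) :
    (𝒜.f i ^ n) x ∈ 𝒜.strip i T := by
  induction n with
  | zero => simpa using hx
  | succ n ih =>
    rw [pow_succ', Module.End.mul_apply]
    exact 𝒜.f_mem_strip i ih

/-- By `serre`, f_j f_i^a t with a ≥ N is a combination of vectors f_i^r f_j f_i^(a') t with a' < a.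
Strong induction on a leaves only exponents below N. The bound N does not depend on T. -/
theorem f_strip_mem (i j : ι) (hij : i ≠ j) : ∃ N : ℕ, ∀ (T : Set M), ∀ x ∈ 𝒜.strip i T,
    𝒜.f j x ∈ 𝒜.strip i (⋃ l ∈ Set.Iio N, (fun t => 𝒜.f j ((𝒜.f i ^ l) t)) '' T) := by
  obtain ⟨N, c, hc⟩ := 𝒜.serre i j hij
  refine ⟨N, fun T x hx => ?_⟩
  refine map_mem_of_mem_span (𝒜.f j) ?_ hx
  rintro _ ⟨a, t, ht, rfl⟩
  induction a using Nat.strong_induction_on with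
  | _ a ih =>
    by_cases ha : a < N
    · refine 𝒜.subset_strip i (Set.mem_biUnion (Set.mem_Iio.mpr ha) ⟨t, ht, rfl⟩)
    · obtain ⟨d, rfl⟩ := Nat.exists_eq_add_of_le (not_lt.mp ha)
      rw [pow_add, Module.End.mul_apply, hc]
      refine Submodule.sum_mem _ fun k hk => Submodule.smul_mem _ _ (𝒜.f_pow_mem_strip i ?_ _)
      have hk' := Finset.mem_range.mp hk
      have := ih (k + d) (by omega)
      rwa [pow_add, Module.End.mul_apply] at this

-- Induction on the number of letters other than `i`. A leading letter `i` preserves the strip, and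
-- any other leading letter is absorbed by `f_strip_mem` into a larger, still finite, set.
open Classical in
theorem exists_strip [Finite ι] (i : ι) (T : Finset M) (hT : ∀ t ∈ T, 𝒜.IsHomogeneous t) (m : ℕ) :
    ∃ T' : Set M, T'.Finite ∧ (∀ t ∈ T', 𝒜.IsHomogeneous t) ∧ ∀ t ∈ T, ∀ w : List ι,
      (w.filter (· ≠ i)).length ≤ m → 𝒜.fWord w t ∈ 𝒜.strip i T' := by
  have hN : ∀ j, ∃ N : ℕ, i ≠ j → ∀ (T : Set M), ∀ x ∈ 𝒜.strip i T,
      𝒜.f j x ∈ 𝒜.strip i (⋃ l ∈ Set.Iio N, (fun t => 𝒜.f j ((𝒜.f i ^ l) t)) '' T) := by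
    intro j
    by_cases hij : i = j
    · exact ⟨0, fun h => absurd hij h⟩
    · obtain ⟨N, h⟩ := 𝒜.f_strip_mem i j hij
      exact ⟨N, fun _ => h⟩
  choose N hN using hN
  induction m with
  | zero =>
    refine ⟨T, T.finite_toSet, hT, fun t ht w hw => ?_⟩
    induction w with
    | nil => exact 𝒜.subset_strip i ht
    | cons j w ih =>
      by_cases hj : j = i
      · subst hj
        rw [fWord_cons]
        exact 𝒜.f_mem_strip j (ih (by simpa using hw))
      · simp [hj] at hw
  | succ m ih =>
    obtain ⟨T', hfin, hhom, hw'⟩ := ih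
    refine ⟨T ∪ ⋃ j, ⋃ l ∈ Set.Iio (N j), (fun t => 𝒜.f j ((𝒜.f i ^ l) t)) '' T', ?_, ?_, ?_⟩
    · exact T.finite_toSet.union (Set.finite_iUnion fun j =>
        (Set.finite_Iio _).biUnion fun l _ => hfin.image _)
    · rintro t (ht | ht)
      · exact hT t ht
      · simp only [Set.mem_iUnion] at ht
        obtain ⟨j, l, -, s, hs, rfl⟩ := ht
        obtain ⟨γ, hγ⟩ := hhom s hs
        exact ⟨_, 𝒜.f_mem j _ _ (𝒜.f_pow_mem i hγ l)⟩
    · intro t ht w hw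
      induction w with
      | nil => exact 𝒜.subset_strip i (Or.inl ht)
      | cons j w ih =>
        rw [fWord_cons]
        by_cases hj : j = i
        · subst hj
          exact 𝒜.f_mem_strip j (ih (by simpa using hw))
        · have h1 : (w.filter (· ≠ i)).length ≤ m := by simpa [hj] using hw
          refine 𝒜.strip_mono i ?_ (hN j (Ne.symm hj) T' _ (hw' t ht w h1))
          exact (Set.subset_iUnion (fun j => ⋃ l ∈ Set.Iio (N j),
            (fun t => 𝒜.f j ((𝒜.f i ^ l) t)) '' T') j).trans Set.subset_union_right

open Classical in
theorem heightAway_content (i : ι) (w : List ι) :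
    heightAway i (content w) = (w.filter (· ≠ i)).length := by
  induction w with
  | nil => simp
  | cons j w ih =>
    rw [content_cons, map_add, ih, heightAway, Finsupp.linearCombination_single]
    by_cases hj : j = i <;> simp [hj, add_comm]

/-- Moving along an α_i-line leaves `heightAway i` unchanged. So, for a fixed generator, all words
with nonzero value on the line have the same number of letters other than `i`, and `exists_strip`
applies. -/
theorem exists_string_generators [Finite ι] (i : ι) (γ₀ : Γ) :
    ∃ T' : Set M, T'.Finite ∧ (∀ t ∈ T', 𝒜.IsHomogeneous t) ∧
      ∀ n : ℤ, 𝒜.wt (γ₀ + n • 𝒟.α i) ≤ 𝒜.strip i T' := by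
  classical
  obtain ⟨T, hT, hspan⟩ := 𝒜.exists_generators
  have hbound : ∀ t, ∃ m : ℕ, t ∈ T → ∀ w (n : ℤ), 𝒜.fWord w t ≠ 0 →
      𝒜.fWord w t ∈ 𝒜.wt (γ₀ + n • 𝒟.α i) → (w.filter (· ≠ i)).length ≤ m := by
    intro t
    by_cases hex : t ∈ T ∧ ∃ w, ∃ n : ℤ, 𝒜.fWord w t ≠ 0 ∧ 𝒜.fWord w t ∈ 𝒜.wt (γ₀ + n • 𝒟.α i)
    · obtain ⟨ht, w₀, n₀, h0, hmem0⟩ := hex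
      refine ⟨(w₀.filter (· ≠ i)).length, fun _ w n hw hmem => ?_⟩
      obtain ⟨γ, hγ⟩ := hT t ht
      have e0 := 𝒜.eq_of_mem_wt h0 hmem0 (𝒜.fWord_mem hγ w₀)
      have e1 := 𝒜.eq_of_mem_wt hw hmem (𝒜.fWord_mem hγ w)
      have e2 : 𝒟.rootHom (content w) =
          𝒟.rootHom (content w₀ + Finsupp.single i (n₀ - n)) := by
        have h0' : 𝒟.rootHom (content w₀) = γ - (γ₀ + n₀ • 𝒟.α i) := by rw [e0, sub_sub_cancel]
        have h1' : 𝒟.rootHom (content w) = γ - (γ₀ + n • 𝒟.α i) := by rw [e1, sub_sub_cancel]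
        rw [map_add, rootHom_single, sub_smul, h0', h1']
        abel
      have e3 := congrArg (heightAway i) (𝒟.rootHom_injective e2)
      rw [map_add, heightAway_content, heightAway_content, heightAway,
        Finsupp.linearCombination_single, if_pos rfl, smul_zero, add_zero] at e3
      exact le_of_eq (by exact_mod_cast e3)
    · exact ⟨0, fun ht w n h1 h2 => absurd ⟨ht, w, n, h1, h2⟩ hex⟩
  choose m hm using hbound
  obtain ⟨T', hfin, hhom, hT'⟩ := 𝒜.exists_strip i T hT (∑ t ∈ T, m t)
  refine ⟨T', hfin, hhom, fun n x hx => ?_⟩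
  have h1 := 𝒜.mem_span_inter (T := {x | ∃ t ∈ T, ∃ w, x = 𝒜.fWord w t}) (by
    rintro _ ⟨t, ht, w, rfl⟩
    obtain ⟨γ, hγ⟩ := hT t ht
    exact ⟨_, 𝒜.fWord_mem hγ w⟩) hx (hspan ▸ Submodule.mem_top)
  refine Submodule.span_le.mpr ?_ h1
  rintro _ ⟨⟨t, ht, w, rfl⟩, hmem⟩
  by_cases h0 : 𝒜.fWord w t = 0
  · rw [h0]; exact Submodule.zero_mem _
  · exact hT' t ht w ((hm t ht w n h0 hmem).trans
      (Finset.single_le_sum (fun _ _ => Nat.zero_le _) ht))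

theorem α_nsmul_injective (𝒟 : WeightDatum ι Γ) (i : ι) {a a' : ℕ}
    (h : a • 𝒟.α i = a' • 𝒟.α i) : a = a' := by
  have : 𝒟.rootHom (Finsupp.single i (a : ℤ)) = 𝒟.rootHom (Finsupp.single i (a' : ℤ)) := by
    simpa [rootHom_single] using h
  exact_mod_cast Finsupp.single_injective i (𝒟.rootHom_injective this)

/-- The weight multiplicities are bounded along every string of weights. -/
theorem exists_string_bound [Finite ι] (i : ι) (γ₀ : Γ) :
    ∃ C : ℕ, ∀ (n : ℤ) (k : ℕ) (v : Fin k → M), LinearIndependent ℂ v →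
      (∀ j, v j ∈ 𝒜.wt (γ₀ + n • 𝒟.α i)) → k ≤ C := by
  classical
  obtain ⟨T', hfin, hhom, hT'⟩ := 𝒜.exists_string_generators i γ₀
  refine ⟨hfin.toFinset.card, fun n k v hv hmem => ?_⟩
  -- A homogeneous t has at most one power f_i^a t in a given weight, because the weights of these
  -- powers are distinct; g picks it, with default 0. The weight space is thus spanned by at most as
  -- many vectors as there are t.
  let g : M → M := fun t =>
    if h : ∃ a : ℕ, (𝒜.f i ^ a) t ≠ 0 ∧ (𝒜.f i ^ a) t ∈ 𝒜.wt (γ₀ + n • 𝒟.α i) then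
      (𝒜.f i ^ h.choose) t else 0
  have hle : 𝒜.wt (γ₀ + n • 𝒟.α i) ≤ Submodule.span ℂ (hfin.toFinset.image g : Set M) := by
    intro x hx
    have h1 := 𝒜.mem_span_inter (by
      rintro _ ⟨a, t, ht, rfl⟩
      obtain ⟨γ, hγ⟩ := hhom t ht
      exact ⟨_, 𝒜.f_pow_mem i hγ a⟩) hx (hT' n hx)
    refine Submodule.span_le.mpr ?_ h1
    rintro _ ⟨⟨a, t, ht, rfl⟩, hm⟩
    by_cases h0 : (𝒜.f i ^ a) t = 0
    · rw [h0]; exact Submodule.zero_mem _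
    · refine Submodule.subset_span ?_
      rw [Finset.mem_coe, Finset.mem_image]
      refine ⟨t, hfin.mem_toFinset.mpr ht, ?_⟩
      have hex : ∃ a : ℕ, (𝒜.f i ^ a) t ≠ 0 ∧ (𝒜.f i ^ a) t ∈ 𝒜.wt (γ₀ + n • 𝒟.α i) := ⟨a, h0, hm⟩
      obtain ⟨γ, hγ⟩ := hhom t ht
      have e1 := 𝒜.eq_of_mem_wt h0 hm (𝒜.f_pow_mem i hγ a)
      have e2 := 𝒜.eq_of_mem_wt hex.choose_spec.1 hex.choose_spec.2 (𝒜.f_pow_mem i hγ _)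
      have : hex.choose = a := α_nsmul_injective 𝒟 i (sub_right_injective (e2.symm.trans e1))
      simp only [g, dif_pos hex]
      rw [this]
  have h2 : Submodule.span ℂ (Set.range v) ≤
      Submodule.span ℂ (hfin.toFinset.image g : Set M) :=
    Submodule.span_le.mpr (by rintro _ ⟨j, rfl⟩; exact hle (hmem j))
  have h3 := Submodule.finrank_mono h2
  rw [finrank_span_eq_card hv, Fintype.card_fin] at h3
  exact h3.trans ((finrank_span_finset_le_card _).trans Finset.card_image_le)

/-- If `M ⊗ M` is again of the same kind, the lowering operators are locally nilpotent on `M`. -/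
theorem exists_f_pow_eq_zero [Finite ι] (𝒳 : WeightAction 𝒟 (M ⊗[ℂ] M))
    (hX : ∀ γ δ x y, x ∈ 𝒜.wt γ → y ∈ 𝒜.wt δ → x ⊗ₜ[ℂ] y ∈ 𝒳.wt (γ + δ))
    (i : ι) {γ : Γ} {v : M} (hv : v ∈ 𝒜.wt γ) : ∃ n : ℕ, (𝒜.f i ^ n) v = 0 := by
  by_contra! hne
  obtain ⟨C, hC⟩ := 𝒳.exists_string_bound i (γ + γ)
  have hli : LinearIndependent ℂ fun n : ℕ => (𝒜.f i ^ n) v := by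
    refine iSupIndep.linearIndependent (fun n : ℕ => 𝒜.wt (γ - n • 𝒟.α i))
      (𝒜.indep.comp fun a b hab => ?_) (fun n => 𝒜.f_pow_mem i hv n) hne
    exact α_nsmul_injective 𝒟 i (sub_right_injective hab)
  have hli2 := hli.tmul_of_isDomain hli
  -- The antidiagonal a ↦ (a, C - a) gives C + 1 independent tensors, all of weight γ + γ - C α_i,
  -- one more than the bound C allows.
  have hli3 := hli2.comp (fun a : Fin (C + 1) => ((a : ℕ), C - a)) fun a b hab => by
    simpa [Fin.ext_iff] using congrArg Prod.fst hab
  have := hC (-C) (C + 1) _ hli3 fun a => by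
    have h1 := hX _ _ _ _ (𝒜.f_pow_mem i hv (a : ℕ)) (𝒜.f_pow_mem i hv (C - a))
    have h2 : γ - (a : ℕ) • 𝒟.α i + (γ - (C - a : ℕ) • 𝒟.α i) = γ + γ + (-C : ℤ) • 𝒟.α i := by
      rw [sub_add_sub_comm, ← add_smul, Nat.add_sub_cancel' (Nat.lt_succ_iff.mp a.2), neg_smul,
        natCast_zsmul, sub_eq_add_neg]
    rw [h2] at h1
    exact h1
  omega

end WeightAction

namespace WeightAction

/-! #### Reflection of weights -/

section Reflection

variable {ι Γ : Type*} [AddCommGroup Γ] {𝒟 : WeightDatum ι Γ} {M : Type*}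
    [AddCommGroup M] [Module ℂ M] (𝒜 : WeightAction 𝒟 M)

/-- Nonzero vectors e_i^n v have distinct weights, hence would be independent inside the
finite-dimensional space spanned by the e-words on v. -/
theorem exists_e_pow_eq_zero (i : ι) {γ : Γ} {v : M} (hv : v ∈ 𝒜.wt γ) :
    ∃ n : ℕ, (𝒜.e i ^ n) v = 0 := by
  by_contra! hne
  have hfin := 𝒜.eFinite v
  have hli : LinearIndependent ℂ fun n : ℕ => (𝒜.e i ^ n) v := by
    refine iSupIndep.linearIndependent (fun n : ℕ => 𝒜.wt (γ + n • 𝒟.α i))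
      (𝒜.indep.comp fun a b hab => ?_) (fun n => 𝒜.e_pow_mem i hv n) hne
    exact α_nsmul_injective 𝒟 i (add_right_injective _ hab)
  have hmem : ∀ n : ℕ, (𝒜.e i ^ n) v ∈
      Submodule.span ℂ (Set.range fun w : List ι => (w.map 𝒜.e).prod v) := fun n =>
    Submodule.subset_span ⟨List.replicate n i, by simp⟩
  have h2 : LinearIndependent ℂ fun n : ℕ => (⟨_, hmem n⟩ :
      Submodule.span ℂ (Set.range fun w : List ι => (w.map 𝒜.e).prod v)) :=
    LinearIndependent.of_comp (Submodule.subtype _) hli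
  exact not_finite_iff_infinite.mpr inferInstance h2.finite

/-- The sl₂ computation: each passage of e_i over a factor f_i adds the scalar φ of the weight
reached. -/
theorem e_f_pow (i : ι) {γ : Γ} {u : M} (hu : u ∈ 𝒜.wt γ) (he : 𝒜.e i u = 0) (n : ℕ) :
    𝒜.e i ((𝒜.f i ^ (n + 1)) u) =
      (∑ k ∈ Finset.range (n + 1), 𝒟.φ i (γ - k • 𝒟.α i)) • (𝒜.f i ^ n) u := by
  induction n with
  | zero => simp [𝒜.comm_same i γ u hu, he]
  | succ n ih =>
    rw [pow_succ', Module.End.mul_apply, 𝒜.comm_same i _ _ (𝒜.f_pow_mem i hu (n + 1)), ih,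
      map_smul, Finset.sum_range_succ _ (n + 1), ← Module.End.mul_apply (𝒜.f i), ← pow_succ']
    module

theorem f_e_pow (i : ι) {γ : Γ} {u : M} (hu : u ∈ 𝒜.wt γ) (hf : 𝒜.f i u = 0) (n : ℕ) :
    𝒜.f i ((𝒜.e i ^ (n + 1)) u) =
      -(∑ k ∈ Finset.range (n + 1), 𝒟.φ i (γ + k • 𝒟.α i)) • (𝒜.e i ^ n) u := by
  have key : ∀ δ x, x ∈ 𝒜.wt δ → 𝒜.f i (𝒜.e i x) = 𝒜.e i (𝒜.f i x) - 𝒟.φ i δ • x := by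
    intro δ x hx
    rw [𝒜.comm_same i δ x hx, add_sub_cancel_right]
  induction n with
  | zero => simp [key γ u hu, hf]
  | succ n ih =>
    rw [pow_succ', Module.End.mul_apply, key _ _ (𝒜.e_pow_mem i hu (n + 1)), ih,
      map_smul, Finset.sum_range_succ _ (n + 1), ← Module.End.mul_apply (𝒜.e i), ← pow_succ']
    module

theorem exists_highest (i : ι) {γ : Γ} {v : M} (hv : v ∈ 𝒜.wt γ) (h0 : v ≠ 0) :
    ∃ (p : ℕ), ∃ u ∈ 𝒜.wt (γ + p • 𝒟.α i), u ≠ 0 ∧ 𝒜.e i u = 0 := by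
  classical
  have hex := 𝒜.exists_e_pow_eq_zero i hv
  obtain ⟨p, hp⟩ : ∃ p, Nat.find hex = p + 1 := Nat.exists_eq_succ_of_ne_zero fun h => h0 (by
    have := Nat.find_spec hex
    rwa [h] at this)
  refine ⟨p, (𝒜.e i ^ p) v, 𝒜.e_pow_mem i hv p, Nat.find_min hex (by omega), ?_⟩
  have := Nat.find_spec hex
  rwa [hp, pow_succ', Module.End.mul_apply] at this

theorem exists_lowest (i : ι) (hf : ∀ γ, ∀ v ∈ 𝒜.wt γ, ∃ n : ℕ, (𝒜.f i ^ n) v = 0)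
    {γ : Γ} {v : M} (hv : v ∈ 𝒜.wt γ) (h0 : v ≠ 0) :
    ∃ (p : ℕ), ∃ u ∈ 𝒜.wt (γ - p • 𝒟.α i), u ≠ 0 ∧ 𝒜.f i u = 0 := by
  classical
  have hex := hf γ v hv
  obtain ⟨p, hp⟩ : ∃ p, Nat.find hex = p + 1 := Nat.exists_eq_succ_of_ne_zero fun h => h0 (by
    have := Nat.find_spec hex
    rwa [h] at this)
  refine ⟨p, (𝒜.f i ^ p) v, 𝒜.f_pow_mem i hv p, Nat.find_min hex (by omega), ?_⟩
  have := Nat.find_spec hex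
  rwa [hp, pow_succ', Module.End.mul_apply] at this

theorem D_sub_nsmul (i : ι) (n : ℕ) {γ : Γ} {m : ℤ} (h : 𝒟.D i γ m) :
    𝒟.D i (γ - n • 𝒟.α i) (m - 2 * n) := by
  have := 𝒟.D_sub_rootHom i (Finsupp.single i (n : ℤ)) γ m h
  rwa [rootHom_single, natCast_zsmul, Finsupp.linearCombination_single, 𝒟.A_self, smul_eq_mul,
    mul_comm] at this

theorem D_add_nsmul (i : ι) (n : ℕ) {γ : Γ} {m : ℤ} (h : 𝒟.D i γ m) :
    𝒟.D i (γ + n • 𝒟.α i) (m + 2 * n) := by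
  have := 𝒟.D_sub_rootHom i (Finsupp.single i (-n : ℤ)) γ m h
  rw [rootHom_single, neg_smul, natCast_zsmul, Finsupp.linearCombination_single, 𝒟.A_self,
    smul_eq_mul, sub_neg_eq_add] at this
  convert this using 1
  ring

/-- The weights of a module with locally nilpotent lowering operators take integral values on the
coroots and are stable under the simple reflections. -/
theorem exists_reflection (i : ι) (hf : ∀ γ, ∀ v ∈ 𝒜.wt γ, ∃ n : ℕ, (𝒜.f i ^ n) v = 0)
    {γ : Γ} (hγ : 𝒜.wt γ ≠ ⊥) : ∃ m : ℤ, 𝒟.D i γ m ∧ 𝒜.wt (γ - m • 𝒟.α i) ≠ ⊥ := by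
  classical
  obtain ⟨v, hv, h0⟩ := Submodule.exists_mem_ne_zero_of_ne_bot hγ
  obtain ⟨p, u, hu, hu0, heu⟩ := 𝒜.exists_highest i hv h0
  have hex := hf _ u hu
  obtain ⟨n, hn⟩ : ∃ n, Nat.find hex = n + 1 := Nat.exists_eq_succ_of_ne_zero fun h => hu0 (by
    have := Nat.find_spec hex
    rwa [h] at this)
  -- n is the last exponent with f_i^n u ≠ 0. Applying e_i to f_i^(n+1) u = 0 kills the scalar of
  -- `e_f_pow`, so the weight of u has value n on the coroot and γ has value n - 2p.
  have hD : 𝒟.D i (γ + p • 𝒟.α i) n := by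
    refine 𝒟.D_of_sum_eq_zero i _ n ?_
    have h1 := 𝒜.e_f_pow i hu heu n
    have h2 := Nat.find_spec hex
    rw [hn] at h2
    rw [h2, map_zero] at h1
    exact (smul_eq_zero.mp h1.symm).resolve_right (Nat.find_min hex (by omega))
  have hD' : 𝒟.D i γ (n - 2 * p) := by
    have := D_sub_nsmul i p hD
    rwa [add_sub_cancel_right] at this
  refine ⟨n - 2 * p, hD', ?_⟩
  -- The reflected weight is γ + pα_i - (n - p)α_i, so for p ≤ n it is reached from u by n - p
  -- lowerings. Otherwise it lies above γ and is reached by raising a lowest vector u'.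
  by_cases hpn : p ≤ n
  · have h1 := 𝒜.f_pow_mem i hu (n - p)
    have h2 : (𝒜.f i ^ (n - p)) u ≠ 0 := Nat.find_min hex (by omega)
    have h3 : γ + p • 𝒟.α i - (n - p) • 𝒟.α i = γ - (n - 2 * p : ℤ) • 𝒟.α i := by
      rw [← natCast_zsmul _ p, ← natCast_zsmul _ (n - p), Nat.cast_sub hpn]
      module
    rw [h3] at h1
    exact Submodule.ne_bot_iff _ |>.mpr ⟨_, h1, h2⟩
  · obtain ⟨r, u', hu', hu0', hfu'⟩ := 𝒜.exists_lowest i hf hv h0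
    have hex' := 𝒜.exists_e_pow_eq_zero i hu'
    obtain ⟨n', hn'⟩ : ∃ n, Nat.find hex' = n + 1 :=
      Nat.exists_eq_succ_of_ne_zero fun h => hu0' (by
        have := Nat.find_spec hex'
        rwa [h] at this)
    have hDl : 𝒟.D i (γ - r • 𝒟.α i + n' • 𝒟.α i) n' := by
      refine 𝒟.D_of_sum_eq_zero i _ n' ?_
      have h1 := 𝒜.f_e_pow i hu' hfu' n'
      have h2 := Nat.find_spec hex'
      rw [hn'] at h2
      rw [h2, map_zero] at h1
      have h3 := (smul_eq_zero.mp h1.symm).resolve_right (Nat.find_min hex' (by omega))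
      -- Reading the sum backwards turns weights counted upwards from u' into weights counted
      -- downwards from the top of its string, as `D_of_sum_eq_zero` requires.
      rw [← neg_eq_zero, ← h3, neg_inj, ← Finset.sum_range_reflect]
      refine Finset.sum_congr rfl fun k hk => ?_
      have hk' : k ≤ n' := Nat.lt_succ_iff.mp (Finset.mem_range.mp hk)
      have h4 : (n' - k) • 𝒟.α i = n' • 𝒟.α i - k • 𝒟.α i := by
        rw [eq_sub_iff_add_eq, ← add_smul, Nat.sub_add_cancel hk']
      rw [show n' + 1 - 1 - k = n' - k by omega, h4]
      congr 1
      abel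
    -- Both strings compute the value of γ on the i-th coroot, so 2r - n' = n - 2p. This is negative
    -- when n < p, whence n' ≥ r and the natural subtraction below is exact.
    have hm : (n' : ℤ) - 2 * n' + 2 * r = n - 2 * p := by
      have h1 := D_add_nsmul i r (D_sub_nsmul i n' hDl)
      rw [add_sub_cancel_right, sub_add_cancel] at h1
      exact 𝒟.D_unique i γ _ _ h1 hD'
    have hr : (r : ℤ) - (n - 2 * p) = ((n' - r : ℕ) : ℤ) := by omega
    have h1 := 𝒜.e_pow_mem i hu' (n' - r)
    have h2 : (𝒜.e i ^ (n' - r)) u' ≠ 0 := Nat.find_min hex' (by omega)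
    have h3 : γ - r • 𝒟.α i + (n' - r) • 𝒟.α i = γ - (n - 2 * p : ℤ) • 𝒟.α i := by
      rw [← natCast_zsmul _ r, ← natCast_zsmul _ (n' - r), ← hr]
      module
    rw [h3] at h1
    exact Submodule.ne_bot_iff _ |>.mpr ⟨_, h1, h2⟩

end Reflection

end WeightAction

/-! ### Finiteness of the Weyl group and vanishing of orbit sums -/

section WeylGroup

open LieAlgebra LieAlgebra.IsKilling Module

variable {g : Type u} [LieRing g] [LieAlgebra ℂ g] [FiniteDimensional ℂ g] [IsKilling ℂ g]
  {H : LieSubalgebra ℂ g} [H.IsCartanSubalgebra] (b : (rootSystem H).Base)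

/-- The group generated by the simple reflections. -/
def simpleWeylGroup : Subgroup (Dual ℂ H ≃ₗ[ℂ] Dual ℂ H) :=
  Subgroup.closure (Set.range fun i : b.support => (rootSystem H).reflection i)

/-- The group permutes the finitely many roots, and since the roots span, an element is determined
by this action. -/
instance : Finite (simpleWeylGroup b) := by
  have hmap : ∀ w ∈ simpleWeylGroup b, ∀ α : H.root, ∃ β : H.root,
      w ((rootSystem H).root α) = (rootSystem H).root β := by
    have hr : ∀ (i : b.support) (α : H.root), ∃ β : H.root,
        (rootSystem H).reflection i ((rootSystem H).root α) = (rootSystem H).root β :=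
      fun i α => ⟨_, ((rootSystem H).root_reflectionPerm i α).symm⟩
    intro w hw
    refine Subgroup.closure_induction_left (p := fun w _ => ∀ α : H.root, ∃ β : H.root,
      w ((rootSystem H).root α) = (rootSystem H).root β) ?_ ?_ ?_ hw
    · exact fun α => ⟨α, rfl⟩
    · rintro _ ⟨i, rfl⟩ y _ hy α
      obtain ⟨β, hβ⟩ := hy α
      rw [LinearEquiv.mul_apply, hβ]
      exact hr i β
    · rintro _ ⟨i, rfl⟩ y _ hy α
      obtain ⟨β, hβ⟩ := hy α
      rw [LinearEquiv.mul_apply, hβ, RootPairing.reflection_inv]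
      exact hr i β
  choose F hF using hmap
  refine Finite.of_injective (fun w : simpleWeylGroup b => F w.1 w.2) fun w w' hww => ?_
  refine Subtype.ext (LinearEquiv.toLinearMap_injective ?_)
  refine LinearMap.ext_on (RootPairing.IsRootSystem.span_root_eq_top (P := rootSystem H)) ?_
  rintro _ ⟨α, rfl⟩
  have := congrFun hww α
  simp only at this
  rw [LinearEquiv.coe_coe, LinearEquiv.coe_coe, hF w.1 w.2 α, hF w'.1 w'.2 α, this]

theorem eq_zero_of_forall_coroot {x : Dual ℂ H}
    (hx : ∀ i : b.support, x ((rootSystem H).coroot i) = 0) : x = 0 :=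
  b.toCoweightBasis.ext fun i => by simpa using hx i

/-- The sum is fixed by each simple reflection, so it vanishes on every simple coroot. -/
theorem sum_simpleWeylGroup [Fintype (simpleWeylGroup b)] (x : Dual ℂ H) :
    ∑ w : simpleWeylGroup b, w.1 x = 0 := by
  refine eq_zero_of_forall_coroot b fun i => ?_
  let s : simpleWeylGroup b :=
    ⟨(rootSystem H).reflection i, Subgroup.subset_closure ⟨i, rfl⟩⟩
  have h1 : (rootSystem H).reflection i (∑ w : simpleWeylGroup b, w.1 x) =
      ∑ w : simpleWeylGroup b, w.1 x := by
    rw [map_sum]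
    exact Fintype.sum_equiv (Equiv.mulLeft s) _ _ fun w => rfl
  rw [RootPairing.reflection_apply, sub_eq_self] at h1
  exact (smul_eq_zero.mp h1).resolve_right ((rootSystem H).ne_zero i)

end WeylGroup

/-! ### Bounds on heights and finite dimensionality -/

section FiniteDimensional

open LieAlgebra LieAlgebra.IsKilling Module

variable {g : Type u} [LieRing g] [LieAlgebra ℂ g] [FiniteDimensional ℂ g] [IsKilling ℂ g]
  {H : LieSubalgebra ℂ g} [H.IsCartanSubalgebra] {b : (rootSystem H).Base}
  {Γ : Type*} [AddCommGroup Γ] {𝒟 : WeightDatum b.support Γ} {M : Type*}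
  [AddCommGroup M] [Module ℂ M] (𝒜 : WeightAction 𝒟 M)

namespace WeightAction

/-- Every weight is that of a word applied to one of finitely many generators, and a word only
lowers weights: n differs from the content of the word by a constant k depending on the generator
alone. -/
theorem exists_le_height (γ : Γ) : ∃ C : ℕ, ∀ n : b.support →₀ ℤ,
    𝒜.wt (γ - 𝒟.rootHom n) ≠ ⊥ → -(C : ℤ) ≤ height n := by
  classical
  obtain ⟨T, hT, hspan⟩ := 𝒜.exists_generators
  have hbound : ∀ t, ∃ C : ℕ, t ∈ T → ∀ (n : b.support →₀ ℤ) w, 𝒜.fWord w t ≠ 0 →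
      𝒜.fWord w t ∈ 𝒜.wt (γ - 𝒟.rootHom n) → -(C : ℤ) ≤ height n := by
    intro t
    by_cases ht : t ∈ T
    · obtain ⟨δ, hδ⟩ := hT t ht
      by_cases hk : ∃ k, 𝒟.rootHom k = γ - δ
      · obtain ⟨k, hk⟩ := hk
        refine ⟨(height k).natAbs, fun _ n w h0 hmem => ?_⟩
        have e1 := 𝒜.eq_of_mem_wt h0 hmem (𝒜.fWord_mem hδ w)
        have e2 : 𝒟.rootHom n = 𝒟.rootHom (k + content w) := by
          rw [map_add, hk, ← sub_sub_cancel γ (𝒟.rootHom n), e1]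
          abel
        rw [𝒟.rootHom_injective e2, map_add, height_content]
        omega
      -- When γ - δ is outside the root lattice, no word takes t into these weights, so any constant
      -- serves.
      · refine ⟨0, fun _ n w h0 hmem => absurd ⟨n - content w, ?_⟩ hk⟩
        have e1 := 𝒜.eq_of_mem_wt h0 hmem (𝒜.fWord_mem hδ w)
        rw [map_sub, ← sub_sub_cancel γ (𝒟.rootHom n), e1]
        abel
    · exact ⟨0, fun h => absurd h ht⟩
  choose C hC using hbound
  refine ⟨∑ t ∈ T, C t, fun n hn => ?_⟩
  obtain ⟨x, hx, hx0⟩ := Submodule.exists_mem_ne_zero_of_ne_bot hn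
  have h1 := 𝒜.mem_span_inter (T := {x | ∃ t ∈ T, ∃ w, x = 𝒜.fWord w t}) (by
    rintro _ ⟨t, ht, w, rfl⟩
    obtain ⟨γ, hγ⟩ := hT t ht
    exact ⟨_, 𝒜.fWord_mem hγ w⟩) hx (hspan ▸ Submodule.mem_top)
  by_contra hlt
  refine hx0 ?_
  have h2 : Submodule.span ℂ ({x | ∃ t ∈ T, ∃ w, x = 𝒜.fWord w t} ∩
      (𝒜.wt (γ - 𝒟.rootHom n) : Set M)) ≤ ⊥ := by
    refine Submodule.span_le.mpr ?_
    rintro _ ⟨⟨t, ht, w, rfl⟩, hm⟩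
    by_contra h0
    have h3 := hC t ht n w h0 hm
    have h4 : C t ≤ ∑ t ∈ T, C t := Finset.single_le_sum (fun _ _ => Nat.zero_le _) ht
    omega
  exact (Submodule.mem_bot ℂ).mp (h2 h1)

/-- A Weyl orbit of weights sums to zero and each of its members has height at most K by
`exists_le_height`. No member can then have a very negative height. -/
theorem exists_height_le (hA : ∀ i j, 𝒟.A i j = cartanEntry b i j)
    (hf : ∀ i γ, ∀ v ∈ 𝒜.wt γ, ∃ n : ℕ, (𝒜.f i ^ n) v = 0) {γ : Γ} (hγ : 𝒜.wt γ ≠ ⊥) : ∃ C : ℕ,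
    ∀ n : b.support →₀ ℤ, 𝒜.wt (γ - 𝒟.rootHom n) ≠ ⊥ → height n ≤ C := by
  classical
  have : Fintype (simpleWeylGroup b) := Fintype.ofFinite _
  obtain ⟨C₀, hC₀⟩ := 𝒜.exists_le_height γ
  choose m hm _ using fun i => 𝒜.exists_reflection i (hf i) hγ
  -- Weights in Γ need not be linear forms. `lam` stands in for γ, with the same values on the
  -- simple coroots, and lam - R n stands in for γ - `rootHom` n, so that the Weyl group can act.
  let lam : Dual ℂ H := b.toCoweightBasis.constr ℂ fun i => (m i : ℂ)
  have hlam : ∀ i : b.support, lam ((rootSystem H).coroot i) = m i := fun i => by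
    have := b.toCoweightBasis.constr_basis ℂ (fun i => (m i : ℂ)) i
    rwa [RootPairing.Base.toCoweightBasis_apply] at this
  let R : (b.support →₀ ℤ) →ₗ[ℤ] Dual ℂ H :=
    Finsupp.linearCombination ℤ fun i : b.support => (rootSystem H).root i
  have hR : ∀ (i : b.support) n, R n ((rootSystem H).coroot i) =
      (Finsupp.linearCombination ℤ (𝒟.A i) n : ℤ) := by
    intro i n
    induction n using Finsupp.induction_linear with
    | zero => simp
    | add x y hx hy => rw [map_add, LinearMap.add_apply, hx, hy, map_add, Int.cast_add]
    | single j z =>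
      rw [Finsupp.linearCombination_single, Finsupp.linearCombination_single, LinearMap.smul_apply,
        root_apply_coroot_eq, hA, zsmul_eq_mul, smul_eq_mul, Int.cast_mul]
  let ht : Dual ℂ H →ₗ[ℂ] ℂ := b.toWeightBasis.constr ℂ fun _ => (1 : ℂ)
  have hht : ∀ n, ht (R n) = (height n : ℤ) := by
    intro n
    induction n using Finsupp.induction_linear with
    | zero => simp
    | add x y hx hy => rw [map_add, map_add, hx, hy, map_add, Int.cast_add]
    | single j z =>
      have := b.toWeightBasis.constr_basis ℂ (fun _ => (1 : ℂ)) j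
      rw [RootPairing.Base.toWeightBasis_apply] at this
      rw [Finsupp.linearCombination_single, map_zsmul, this, height,
        Finsupp.linearCombination_single]
      simp
  let P : Dual ℂ H → Prop := fun x => ∃ n, x = lam - R n ∧ 𝒜.wt (γ - 𝒟.rootHom n) ≠ ⊥
  -- By uniqueness of the coroot value, the multiple k of α_i supplied by `exists_reflection` is
  -- exactly the pairing of lam - R n with the coroot.
  have hrefl : ∀ (i : b.support) x, P x → P ((rootSystem H).reflection i x) := by
    rintro i _ ⟨n, rfl, hn⟩
    obtain ⟨k, hk, hk'⟩ := 𝒜.exists_reflection i (hf i) hn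
    have hkm := 𝒟.D_unique i _ _ _ hk (𝒟.D_sub_rootHom i n _ _ (hm i))
    refine ⟨n + Finsupp.single i k, ?_, ?_⟩
    · rw [RootPairing.reflection_apply, map_add, ← sub_sub]
      congr 1
      have h1 : (lam - R n) ((rootSystem H).coroot i) = (k : ℂ) := by
        rw [LinearMap.sub_apply, hlam, hR, hkm, Int.cast_sub]
      rw [Finsupp.linearCombination_single, ← Int.cast_smul_eq_zsmul ℂ, ← h1]
      rfl
    · rwa [map_add, rootHom_single, ← sub_sub]
  have hP : ∀ w ∈ simpleWeylGroup b, ∀ x, P x → P (w x) := by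
    intro w hw
    refine Subgroup.closure_induction_left (p := fun w _ => ∀ x, P x → P (w x)) ?_ ?_ ?_ hw
    · exact fun x hx => hx
    · rintro _ ⟨i, rfl⟩ y _ hy x hx
      exact hrefl i _ (hy x hx)
    · rintro _ ⟨i, rfl⟩ y _ hy x hx
      rw [RootPairing.reflection_inv]
      exact hrefl i _ (hy x hx)
  let K : ℝ := |(ht lam).re| + C₀
  have hK : ∀ x, P x → (ht x).re ≤ K := by
    rintro _ ⟨n, rfl, hn⟩
    have h1 : -(C₀ : ℝ) ≤ (height n : ℤ) := by exact_mod_cast hC₀ n hn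
    rw [map_sub, hht, Complex.sub_re, Complex.intCast_re]
    have := le_abs_self (ht lam).re
    simp only [K]
    linarith
  -- In the vanishing orbit sum the identity contributes ht lam - height n and the other terms at
  -- most |W| K in total, so height n ≤ ht lam + |W| K.
  refine ⟨⌈|(ht lam).re| + Fintype.card (simpleWeylGroup b) * K⌉₊, fun n hn => ?_⟩
  have hsum := congrArg (fun x => (ht x).re) (sum_simpleWeylGroup b (lam - R n))
  simp only [map_sum, Complex.re_sum, map_zero, Complex.zero_re] at hsum
  rw [← Finset.add_sum_erase _ _ (Finset.mem_univ (1 : simpleWeylGroup b))] at hsum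
  have hrest : ∑ w ∈ Finset.univ.erase (1 : simpleWeylGroup b), (ht (w.1 (lam - R n))).re ≤
      Fintype.card (simpleWeylGroup b) * K := by
    have hK0 : 0 ≤ K := by positivity
    calc _ ≤ ∑ w ∈ Finset.univ.erase (1 : simpleWeylGroup b), K :=
          Finset.sum_le_sum fun w _ => hK _ (hP w.1 w.2 _ ⟨n, rfl, hn⟩)
      _ ≤ ∑ w : simpleWeylGroup b, K :=
          Finset.sum_le_sum_of_subset_of_nonneg (Finset.erase_subset _ _) fun _ _ _ => hK0
      _ = _ := by rw [Finset.sum_const, Finset.card_univ, nsmul_eq_mul]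
  have h1 : (ht ((1 : simpleWeylGroup b).1 (lam - R n))).re = (ht lam).re - (height n : ℤ) := by
    rw [OneMemClass.coe_one, LinearEquiv.coe_one, id, map_sub, hht, Complex.sub_re,
      Complex.intCast_re]
  rw [h1] at hsum
  have h2 := Nat.le_ceil (|(ht lam).re| + Fintype.card (simpleWeylGroup b) * K)
  have h3 := le_abs_self (ht lam).re
  have h4 : ((height n : ℤ) : ℝ) ≤
      (⌈|(ht lam).re| + Fintype.card (simpleWeylGroup b) * K⌉₊ : ℕ) := by linarith
  exact_mod_cast h4

/-- If the lowering operators are locally nilpotent, the module is finite dimensional. -/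
theorem finiteDimensional (hA : ∀ i j, 𝒟.A i j = cartanEntry b i j)
    (hf : ∀ i γ, ∀ v ∈ 𝒜.wt γ, ∃ n : ℕ, (𝒜.f i ^ n) v = 0) : FiniteDimensional ℂ M := by
  classical
  obtain ⟨T, hT, hspan⟩ := 𝒜.exists_generators
  -- The height of the content of a word is its length, so the height bound kills all long words on
  -- each generator.
  have hlen : ∀ t, ∃ C : ℕ, t ∈ T → ∀ w, 𝒜.fWord w t ≠ 0 → w.length ≤ C := by
    intro t
    by_cases ht : t ∈ T
    · obtain ⟨γ, hγ⟩ := hT t ht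
      by_cases h0 : 𝒜.wt γ = ⊥
      · refine ⟨0, fun _ w hw => absurd ?_ hw⟩
        rw [h0, Submodule.mem_bot] at hγ
        rw [hγ, map_zero]
      · obtain ⟨C, hC⟩ := 𝒜.exists_height_le hA hf h0
        refine ⟨C, fun _ w hw => ?_⟩
        have := hC (content w) ((Submodule.ne_bot_iff _).mpr ⟨_, 𝒜.fWord_mem hγ w, hw⟩)
        rw [height_content] at this
        exact_mod_cast this
    · exact ⟨0, fun h => absurd h ht⟩
  choose C hC using hlen
  have hfin : (⋃ t ∈ T, (fun w => 𝒜.fWord w t) '' {w : List b.support | w.length ≤ C t}).Finite :=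
    T.finite_toSet.biUnion fun t _ => (List.finite_length_le _ _).image _
  have htop : Submodule.span ℂ
      (⋃ t ∈ T, (fun w => 𝒜.fWord w t) '' {w : List b.support | w.length ≤ C t}) = ⊤ := by
    refine top_le_iff.mp (hspan ▸ Submodule.span_le.mpr ?_)
    rintro _ ⟨t, ht, w, rfl⟩
    by_cases h0 : 𝒜.fWord w t = 0
    · rw [h0]; exact Submodule.zero_mem _
    · exact Submodule.subset_span (Set.mem_biUnion ht ⟨w, hC t ht w h0, rfl⟩)
  have := FiniteDimensional.span_of_finite ℂ hfin
  rw [htop] at this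
  exact Module.Finite.equiv Submodule.topEquiv

/-- If `M ⊗ M` carries the same structure compatibly with weights, then `M` is finite
dimensional. -/
theorem finiteDimensional_of_tensor (hA : ∀ i j, 𝒟.A i j = cartanEntry b i j)
    (𝒳 : WeightAction 𝒟 (M ⊗[ℂ] M))
    (hX : ∀ γ δ x y, x ∈ 𝒜.wt γ → y ∈ 𝒜.wt δ → x ⊗ₜ[ℂ] y ∈ 𝒳.wt (γ + δ)) :
    FiniteDimensional ℂ M :=
  𝒜.finiteDimensional hA fun i _ _ hv => 𝒜.exists_f_pow_eq_zero 𝒳 hX i hv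

end WeightAction
end FiniteDimensional

/-! ### The quantum group -/

/-! ### Stabilizers and orbits of subspaces -/

section StableSubspaces

variable {A : Type*} [Ring A] [Algebra ℂ A] {V : Type*} [AddCommGroup V] [Module ℂ V]

/-- The subalgebra of elements that preserve a subspace. -/
def stabilizerSubalgebra (ρ : A →ₐ[ℂ] Module.End ℂ V) (Y : Submodule ℂ V) : Subalgebra ℂ A where
  carrier := {a | ∀ y ∈ Y, ρ a y ∈ Y}
  mul_mem' := fun {a a'} ha ha' y hy => by
    rw [map_mul, Module.End.mul_apply]
    exact ha _ (ha' _ hy)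
  add_mem' := fun {a a'} ha ha' y hy => by
    rw [map_add, LinearMap.add_apply]
    exact Y.add_mem (ha _ hy) (ha' _ hy)
  algebraMap_mem' := fun r y hy => by
    rw [AlgHom.commutes, Module.algebraMap_end_apply]
    exact Y.smul_mem r hy

theorem mem_orbitSpace {S : Subalgebra ℂ A} {ρ : A →ₐ[ℂ] Module.End ℂ V} {v w : V} :
    w ∈ orbitSpace S ρ v ↔ ∃ a ∈ S, ρ a v = w := by
  simp [orbitSpace]

theorem orbitSpace_le {S : Subalgebra ℂ A} {ρ : A →ₐ[ℂ] Module.End ℂ V} {Y : Submodule ℂ V}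
    (hS : S ≤ stabilizerSubalgebra ρ Y) {v : V} (hv : v ∈ Y) : orbitSpace S ρ v ≤ Y := by
  intro w hw
  obtain ⟨a, ha, rfl⟩ := mem_orbitSpace.mp hw
  exact hS ha v hv

theorem le_stabilizer_orbitSpace (S : Subalgebra ℂ A) (ρ : A →ₐ[ℂ] Module.End ℂ V) (v : V) :
    S ≤ stabilizerSubalgebra ρ (orbitSpace S ρ v) := by
  intro a ha w hw
  obtain ⟨c, hc, rfl⟩ := mem_orbitSpace.mp hw
  exact mem_orbitSpace.mpr ⟨a * c, S.mul_mem ha hc, by rw [map_mul, Module.End.mul_apply]⟩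

end StableSubspaces

/-! ### Weights of the quantum group as characters of the weight lattice -/

section Quantum

open LieAlgebra LieAlgebra.IsKilling Module

variable {g : Type u} [LieRing g] [LieAlgebra ℂ g] [FiniteDimensional ℂ g] [IsKilling ℂ g]
  {H : LieSubalgebra ℂ g} [H.IsCartanSubalgebra] {b : (rootSystem H).Base}
  {B : LinearMap.BilinForm ℂ (Dual ℂ H)} {h : ℝ}

theorem uq_mem_of_generators {S : Subalgebra ℂ (Uq b B h)} (hK : ∀ mu, uqK b B h mu ∈ S)
    (hE : ∀ i, uqE b B h i ∈ S) (hF : ∀ i, uqF b B h i ∈ S) (a : Uq b B h) : a ∈ S := by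
  obtain ⟨x, rfl⟩ := RingQuot.mkAlgHom_surjective ℂ (UqRel b B h) a
  induction x using FreeAlgebra.induction with
  | grade0 r => rw [AlgHom.commutes]; exact S.algebraMap_mem r
  | grade1 x =>
    cases x with
    | K mu => exact hK mu
    | E i => exact hE i
    | F i => exact hF i
  | mul x y hx hy => rw [map_mul]; exact S.mul_mem hx hy
  | add x y hx hy => rw [map_add]; exact S.add_mem hx hy

theorem qPow_zpow (x : ℂ) (n : ℤ) : qPow h x ^ n = qPow h (n * x) := by
  rw [qPow, qPow, ← Complex.exp_int_mul]
  congr 1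
  ring

theorem qPow_form (hB : IsRescaledKillingForm B) (i j : b.support) :
    qPow h (B ((rootSystem H).root i) ((rootSystem H).root j)) =
      qRoot b B h i ^ cartanEntry b i j := by
  rw [qRoot, qPow_zpow]
  congr 1
  linear_combination (1 / 2 : ℂ) * form_root_mul b hB i j

theorem qRoot_zpow_eq_one (hB : IsRescaledKillingForm B) (hh : h ≠ 0) (i : b.support) {n : ℤ}
    (hn : qRoot b B h i ^ (2 * n) = 1) : n = 0 := by
  by_contra h0
  refine qRoot_pow_ne_one b hB hh i n.natAbs (Int.natAbs_pos.mpr h0) ?_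
  rw [← zpow_natCast, Nat.cast_mul, Nat.cast_ofNat]
  rcases Int.natAbs_eq n with h1 | h1
  · rwa [← h1]
  · rw [← inv_inj, ← zpow_neg, ← mul_neg, ← h1, hn, inv_one]

/-- The homomorphism `z ↦ q ^ z` into the group of nonzero complex numbers. -/
noncomputable def qUnit (h : ℝ) (z : ℂ) : Additive ℂˣ :=
  Additive.ofMul (Units.mk0 (qPow h z) (qPow_ne_zero h z))

theorem coe_qUnit (z : ℂ) : ((qUnit h z).toMul : ℂ) = qPow h z := rfl

/-- The group of maps from the weight lattice to the nonzero complex numbers; it contains the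
weights of `U_q(g)`-modules. -/
abbrev QWeight (b : (rootSystem H).Base) : Type u := weightLattice b → Additive ℂˣ

/-- The value of a weight at a simple root. -/
noncomputable def QWeight.val (γ : QWeight b) (i : b.support) : ℂ := ((γ (simpleRoot b i)).toMul : ℂ)

/-- The simple roots as weights. -/
noncomputable def qRootWeight (B : LinearMap.BilinForm ℂ (Dual ℂ H)) (h : ℝ) (j : b.support) :
    QWeight b := fun mu => qUnit h (B mu (simpleRoot b j))

theorem QWeight.val_ne_zero (γ : QWeight b) (i : b.support) : γ.val i ≠ 0 := Units.ne_zero _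

theorem QWeight.val_add (γ δ : QWeight b) (i : b.support) :
    QWeight.val (γ + δ) i = γ.val i * δ.val i := by
  simp [QWeight.val]

theorem QWeight.val_sub (γ δ : QWeight b) (i : b.support) :
    QWeight.val (γ - δ) i = γ.val i / δ.val i := by
  simp [QWeight.val]

theorem QWeight.val_zsmul (n : ℤ) (γ : QWeight b) (i : b.support) :
    QWeight.val (n • γ) i = γ.val i ^ n := by
  simp [QWeight.val]

theorem val_qRootWeight (hB : IsRescaledKillingForm B) (i j : b.support) :
    (qRootWeight B h j).val i = qRoot b B h i ^ cartanEntry b i j := qPow_form hB i j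

/-- Evaluating a relation at α_j gives a power of q_j equal to 1. As q_j is not a root of unity, the
exponent vanishes, so ∑ n_i α_i is zero on all simple coroots and hence zero. -/
theorem linearIndependent_qRootWeight (hB : IsRescaledKillingForm B) (hh : h ≠ 0) :
    LinearIndependent ℤ (qRootWeight (b := b) B h) := by
  rw [Fintype.linearIndependent_iff]
  intro n hn
  have hval : ∀ j : b.support, ∑ i, n i * cartanEntry b j i = 0 := by
    intro j
    have h1 : ∀ s : Finset b.support, QWeight.val (∑ i ∈ s, n i • qRootWeight B h i) j =
        qRoot b B h j ^ (∑ i ∈ s, n i * cartanEntry b j i) := by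
      classical
      intro s
      induction s using Finset.induction_on with
      | empty => simp [QWeight.val]
      | insert i s his ih =>
        rw [Finset.sum_insert his, Finset.sum_insert his, QWeight.val_add, ih, QWeight.val_zsmul,
          val_qRootWeight hB, zpow_add₀ (qRoot_ne_zero b B h j), ← zpow_mul, mul_comm (n i)]
    have h2 := h1 Finset.univ
    rw [hn] at h2
    refine qRoot_zpow_eq_one hB hh j ?_
    rw [mul_comm, zpow_mul, ← h2]
    simp [QWeight.val]
  have hx : ∑ i : b.support, (n i : ℂ) • (rootSystem H).root i = 0 := by
    refine eq_zero_of_forall_coroot b fun j => ?_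
    rw [LinearMap.sum_apply]
    simp only [LinearMap.smul_apply, root_apply_coroot_eq, smul_eq_mul]
    exact_mod_cast hval j
  have hli := b.toWeightBasis.linearIndependent
  rw [Fintype.linearIndependent_iff] at hli
  intro i
  have := hli (fun i => (n i : ℂ)) (by simpa using hx) i
  exact_mod_cast this

/-- With S = ∑ q^(2k), the sum is a nonzero multiple of (κ q^(-2n) - κ⁻¹) S, and S ≠ 0 as a
geometric sum at a non-root of unity. Only κ² is determined: the sign κ = ±q^n remains free. -/
theorem sq_eq_of_sum_eq_zero {q κ : ℂ} (h0 : q ≠ 0) (hq : ∀ m : ℕ, 0 < m → q ^ (2 * m) ≠ 1)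
    (hκ : κ ≠ 0) (n : ℕ) (hsum : ∑ k ∈ Finset.range (n + 1), (q - q⁻¹)⁻¹ *
      (κ * (q ^ (2 * k))⁻¹ - (κ * (q ^ (2 * k))⁻¹)⁻¹) = 0) : κ ^ 2 = q ^ (2 * (n : ℤ)) := by
  have hc : (q - q⁻¹)⁻¹ ≠ 0 := by
    refine inv_ne_zero fun h1 => hq 1 one_pos ?_
    rw [mul_one, sq]
    nth_rewrite 2 [sub_eq_zero.mp h1]
    exact mul_inv_cancel₀ h0
  have hS : ∑ k ∈ Finset.range (n + 1), q ^ (2 * k) ≠ 0 := by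
    intro h1
    have h2 := mul_geom_sum (q ^ 2) (n + 1)
    simp only [← pow_mul] at h2
    rw [h1, mul_zero] at h2
    exact hq (n + 1) n.succ_pos (sub_eq_zero.mp h2.symm)
  have hrefl : ∑ k ∈ Finset.range (n + 1), (q ^ (2 * k))⁻¹ =
      (q ^ (2 * n))⁻¹ * ∑ k ∈ Finset.range (n + 1), q ^ (2 * k) := by
    rw [← Finset.sum_range_reflect, Finset.mul_sum]
    refine Finset.sum_congr rfl fun k hk => ?_
    have hk' : k ≤ n := Nat.lt_succ_iff.mp (Finset.mem_range.mp hk)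
    obtain ⟨d, rfl⟩ := Nat.exists_eq_add_of_le hk'
    rw [show k + d + 1 - 1 - k = d by omega, mul_add, pow_add, mul_inv, mul_right_comm,
      inv_mul_cancel₀ (pow_ne_zero _ h0), one_mul]
  rw [← Finset.mul_sum] at hsum
  have h1 := (mul_eq_zero.mp hsum).resolve_left hc
  simp only [mul_inv, inv_inv] at h1
  rw [Finset.sum_sub_distrib, ← Finset.mul_sum, ← Finset.mul_sum, hrefl] at h1
  have h2 : κ * (q ^ (2 * n))⁻¹ - κ⁻¹ = 0 := by
    refine (mul_eq_zero.mp ?_).resolve_right hS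
    rw [sub_mul, ← h1]
    ring
  have hqn : q ^ (2 * n) ≠ 0 := pow_ne_zero _ h0
  have h3 : κ ^ 2 = q ^ (2 * n) := by
    field_simp at h2
    linear_combination h2
  rw [h3]
  exact_mod_cast (zpow_natCast q (2 * n)).symm

/-- The weight datum of `U_q(g)`. -/
noncomputable def qDatum (b : (rootSystem H).Base) (hB : IsRescaledKillingForm B) (hh : h ≠ 0) :
    WeightDatum b.support (QWeight b) where
  α := qRootWeight B h
  φ := fun i γ => (qRoot b B h i - (qRoot b B h i)⁻¹)⁻¹ * (γ.val i - (γ.val i)⁻¹)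
  A := cartanEntry b
  -- Squares absorb the sign left open by `sq_eq_of_sum_eq_zero`; m is still unique because q_i is
  -- not a root of unity.
  D := fun i γ m => γ.val i ^ 2 = qRoot b B h i ^ (2 * m)
  linInd := linearIndependent_qRootWeight hB hh
  A_self := fun i => by
    have := root_apply_coroot_eq b i i
    exact_mod_cast this.symm.trans ((rootSystem H).root_coroot_two i)
  D_of_sum_eq_zero := by
    intro i γ n hsum
    have hA : cartanEntry b i i = 2 := by
      have := root_apply_coroot_eq b i i
      exact_mod_cast this.symm.trans ((rootSystem H).root_coroot_two i)
    have hκ := γ.val_ne_zero i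
    have hval : ∀ k : ℕ, QWeight.val (γ - k • qRootWeight B h i) i =
        γ.val i * (qRoot b B h i ^ (2 * k))⁻¹ := fun k => by
      rw [QWeight.val_sub, ← natCast_zsmul, QWeight.val_zsmul, val_qRootWeight hB, hA, ← zpow_mul,
        div_eq_mul_inv]
      congr 2
    simp only [hval] at hsum
    exact sq_eq_of_sum_eq_zero (qRoot_ne_zero b B h i)
      (fun m hm => qRoot_pow_ne_one b hB hh i m hm) hκ n hsum
  D_sub := by
    intro i j γ m hm
    rw [QWeight.val_sub, val_qRootWeight hB, div_pow, hm, mul_sub,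
      zpow_sub₀ (qRoot_ne_zero b B h i), mul_comm 2 (cartanEntry b i j), zpow_mul _ _ (2 : ℤ)]
    rfl
  D_add := by
    intro i j γ m hm
    rw [QWeight.val_add, val_qRootWeight hB, mul_pow, hm, mul_add,
      zpow_add₀ (qRoot_ne_zero b B h i), mul_comm 2 (cartanEntry b i j), zpow_mul _ _ (2 : ℤ)]
    rfl
  D_unique := by
    intro i γ m m' hm hm'
    refine sub_eq_zero.mp (qRoot_zpow_eq_one hB hh i ?_)
    rw [mul_sub, zpow_sub₀ (qRoot_ne_zero b B h i), ← hm, ← hm',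
      div_self (pow_ne_zero _ (γ.val_ne_zero i))]

end Quantum

/-! ### Modules over the quantum group as weight-graded spaces -/

section QuantumModules

open LieAlgebra LieAlgebra.IsKilling Module

variable {g : Type u} [LieRing g] [LieAlgebra ℂ g] [FiniteDimensional ℂ g] [IsKilling ℂ g]
  {H : LieSubalgebra ℂ g} [H.IsCartanSubalgebra] {b : (rootSystem H).Base}
  {B : LinearMap.BilinForm ℂ (Dual ℂ H)} {h : ℝ}
  {V : Type*} [AddCommGroup V] [Module ℂ V] {W : Type*} [AddCommGroup W] [Module ℂ W]

/-- The weight spaces of a `U_q(g)`-module. -/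
def qWt (ρ : Uq b B h →ₐ[ℂ] Module.End ℂ V) (γ : QWeight b) : Submodule ℂ V :=
  ⨅ mu : weightLattice b, Module.End.eigenspace (ρ (uqK b B h mu)) ((γ mu).toMul : ℂ)

theorem mem_qWt {ρ : Uq b B h →ₐ[ℂ] Module.End ℂ V} {γ : QWeight b} {x : V} :
    x ∈ qWt ρ γ ↔ ∀ mu, ρ (uqK b B h mu) x = ((γ mu).toMul : ℂ) • x := by
  simp [qWt]

theorem mem_uqWeightSpace {ρ : Uq b B h →ₐ[ℂ] Module.End ℂ V} {lam : Dual ℂ H} {x : V} :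
    x ∈ uqWeightSpace ρ lam ↔
      ∀ mu : weightLattice b, ρ (uqK b B h mu) x = qPow h (B lam mu) • x := by
  simp [uqWeightSpace]

/-- The K_μ commute, so their simultaneous generalized eigenspaces for distinct characters are
independent. -/
theorem iSupIndep_qWt (ρ : Uq b B h →ₐ[ℂ] Module.End ℂ V) : iSupIndep (qWt ρ) := by
  have h1 := Module.End.independent_iInf_maxGenEigenspace_of_forall_mapsTo
    (fun mu : weightLattice b => ρ (uqK b B h mu)) fun i j φ =>
      Module.End.mapsTo_maxGenEigenspace_of_comm (by
        rw [commute_iff_eq, ← map_mul, ← map_mul, uqK_comm]) φ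
  have h2 := h1.comp (f := fun γ : QWeight b => fun mu => ((γ mu).toMul : ℂ))
    fun γ δ hγδ => funext fun mu => Additive.toMul.injective (Units.ext (congrFun hγδ mu))
  refine iSupIndep.mono h2 ?_
  intro γ
  exact iInf_mono fun mu => (Module.End.genEigenspace _ _).mono le_top

theorem iSup_qWt {ρ : Uq b B h →ₐ[ℂ] Module.End ℂ V} (hρ : IsInO ρ) : ⨆ γ, qWt ρ γ = ⊤ := by
  rw [← top_le_iff, ← hρ.weight]
  exact iSup_le fun lam => le_iSup_of_le (fun mu => qUnit h (B lam mu)) le_rfl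

theorem uqE_mem_qWt (ρ : Uq b B h →ₐ[ℂ] Module.End ℂ V) (i : b.support) {γ : QWeight b} {x : V}
    (hx : x ∈ qWt ρ γ) : ρ (uqE b B h i) x ∈ qWt ρ (γ + qRootWeight B h i) := by
  rw [mem_qWt] at hx ⊢
  intro mu
  rw [← Module.End.mul_apply, ← map_mul, uqK_mul_uqE, map_smul, map_mul, LinearMap.smul_apply,
    Module.End.mul_apply, hx, map_smul, smul_smul, mul_comm]
  rfl

theorem uqF_mem_qWt (ρ : Uq b B h →ₐ[ℂ] Module.End ℂ V) (i : b.support) {γ : QWeight b} {x : V}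
    (hx : x ∈ qWt ρ γ) : ρ (uqF b B h i) x ∈ qWt ρ (γ - qRootWeight B h i) := by
  rw [mem_qWt] at hx ⊢
  intro mu
  rw [← Module.End.mul_apply, ← map_mul, uqK_mul_uqF, map_smul, map_mul, LinearMap.smul_apply,
    Module.End.mul_apply, hx, map_smul, smul_smul, mul_comm]
  congr 1
  rw [Pi.sub_apply, toMul_sub, Units.val_div_eq_div_val, qRootWeight, coe_qUnit, div_eq_mul_inv]
  congr 1
  rw [qPow, qPow, ← Complex.exp_neg, mul_neg]

theorem uqK_neg_apply (ρ : Uq b B h →ₐ[ℂ] Module.End ℂ V) {γ : QWeight b} {x : V}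
    (hx : x ∈ qWt ρ γ) (mu : weightLattice b) :
    ρ (uqK b B h (-mu)) x = ((γ mu).toMul : ℂ)⁻¹ • x := by
  have h1 : ρ (uqK b B h (-mu)) (ρ (uqK b B h mu) x) = x := by
    rw [← Module.End.mul_apply, ← map_mul, uqK_neg_mul, map_one, Module.End.one_apply]
  rw [mem_qWt.mp hx, map_smul] at h1
  rw [eq_inv_smul_iff₀ (Units.ne_zero _), h1]

/-- The quantum Serre relation solved for its last term F_j F_i^n, whose coefficient is ±1. -/
theorem uqF_mul_pow (hB : IsRescaledKillingForm B) (hh : h ≠ 0) (i j : b.support) (hij : i ≠ j) :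
    ∃ (N : ℕ) (c : ℕ → ℂ), uqF b B h j * uqF b B h i ^ N =
      ∑ k ∈ Finset.range N, c k • (uqF b B h i ^ (N - k) * (uqF b B h j * uqF b B h i ^ k)) := by
  have h1 := uq_serre_F b B h i j hij
  set n := (1 - cartanEntry b i j).toNat
  refine ⟨n, fun k => -((-1) ^ n * ((-1) ^ k * qBinom (qRoot b B h i) n k)), ?_⟩
  rw [qSerre, Finset.sum_range_succ, Nat.sub_self, pow_zero, one_mul,
    qBinom_self (qRoot_ne_zero b B h i) (fun m hm => qRoot_pow_ne_one b hB hh i m hm), mul_one,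
    add_comm] at h1
  have h2 := congrArg (fun x => (-1 : ℂ) ^ n • x) (eq_neg_of_add_eq_zero_left h1)
  simp only [smul_smul, ← mul_pow, neg_one_mul, neg_neg, one_pow, one_smul] at h2
  rw [h2, smul_neg, Finset.smul_sum, ← Finset.sum_neg_distrib]
  refine Finset.sum_congr rfl fun k _ => ?_
  rw [smul_smul, mul_assoc (uqF b B h i ^ (n - k))]
  exact (neg_smul _ _).symm

/-- An object of the category `O` of `U_q(g)` as a weight-graded space. -/
def qAction (hB : IsRescaledKillingForm B) (hh : h ≠ 0) {ρ : Uq b B h →ₐ[ℂ] Module.End ℂ V}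
    (hρ : IsInO ρ) : WeightAction (qDatum b hB hh) V where
  wt := qWt ρ
  e := fun i => ρ (uqE b B h i)
  f := fun i => ρ (uqF b B h i)
  indep := iSupIndep_qWt ρ
  iSup_wt := iSup_qWt hρ
  e_mem := fun i _ _ hx => uqE_mem_qWt ρ i hx
  f_mem := fun i _ _ hx => uqF_mem_qWt ρ i hx
  comm_same := by
    intro i γ x hx
    have h1 := congrArg (fun a => ρ a x) (uqE_F_same b B h i)
    simp only [map_sub, map_mul, map_smul, LinearMap.sub_apply, Module.End.mul_apply,
      LinearMap.smul_apply] at h1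
    rw [uqK_neg_apply ρ hx, mem_qWt.mp hx, ← sub_smul, smul_smul, sub_eq_iff_eq_add'] at h1
    exact h1
  comm_ne := by
    intro i j hij x
    have h1 := congrArg (fun a => ρ a x) (uqE_F_ne b B h i j hij)
    simpa only [map_sub, map_mul, map_zero, LinearMap.sub_apply, Module.End.mul_apply,
      LinearMap.zero_apply, sub_eq_zero] using h1
  eFinite := by
    intro v
    have := hρ.locallyFinite v
    refine Submodule.finiteDimensional_of_le (S₂ := orbitSpace (uqNPlus b B h) ρ v)
      (Submodule.span_le.mpr ?_)
    rintro _ ⟨w, rfl⟩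
    refine mem_orbitSpace.mpr ⟨(w.map (uqE b B h)).prod, ?_, ?_⟩
    · refine Subalgebra.list_prod_mem _ fun a ha => ?_
      obtain ⟨i, -, rfl⟩ := List.mem_map.mp ha
      exact Algebra.subset_adjoin ⟨i, rfl⟩
    · rw [map_list_prod, List.map_map]
      rfl
  fg := by
    obtain ⟨S, hS⟩ := hρ.finitelyGenerated
    refine ⟨S, fun Y hSY he hf hwt => ?_⟩
    have hstab : ∀ a, a ∈ stabilizerSubalgebra ρ Y := by
      refine uq_mem_of_generators (fun mu y hy => ?_) (fun i y hy => he i y hy)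
        (fun i y hy => hf i y hy)
      -- K_μ acts by a scalar on each homogeneous part, so a graded subspace is stable under it.
      have : (⨆ γ, Y ⊓ qWt ρ γ) ≤ Y.comap (ρ (uqK b B h mu)) := by
        refine iSup_le fun γ y hy => ?_
        rw [Submodule.mem_comap, mem_qWt.mp hy.2]
        exact Y.smul_mem _ hy.1
      exact this (hwt hy)
    rw [← top_le_iff, ← hS, Submodule.span_le]
    rintro _ ⟨a, v, hv, rfl⟩
    exact hstab a v (hSY hv)
  serre := by
    intro i j hij
    obtain ⟨N, c, hc⟩ := uqF_mul_pow hB hh i j hij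
    refine ⟨N, c, fun x => ?_⟩
    have h1 := congrArg (fun a => ρ a x) hc
    simpa only [map_sum, map_mul, map_pow, map_smul, LinearMap.sum_apply, LinearMap.smul_apply,
      Module.End.mul_apply] using h1

/-! ### Tensor products of quantum modules -/

section Tensor

variable (hB : IsRescaledKillingForm B) (hh : h ≠ 0) (ρ : Uq b B h →ₐ[ℂ] Module.End ℂ V)
  (σ : Uq b B h →ₐ[ℂ] Module.End ℂ W)

theorem uqTensor_uqK (mu : weightLattice b) (x : V) (y : W) :
    uqTensor hB hh ρ σ (uqK b B h mu) (x ⊗ₜ y) = ρ (uqK b B h mu) x ⊗ₜ σ (uqK b B h mu) y := by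
  simp [uqTensor, uqComul_uqK, Module.endTensorEndAlgHom_apply]

theorem uqTensor_uqE (i : b.support) (x : V) (y : W) :
    uqTensor hB hh ρ σ (uqE b B h i) (x ⊗ₜ y) =
      ρ (uqE b B h i) x ⊗ₜ σ (uqK b B h (simpleRoot b i)) y + x ⊗ₜ σ (uqE b B h i) y := by
  simp [uqTensor, uqComul_uqE, Module.endTensorEndAlgHom_apply]

theorem uqTensor_uqF (i : b.support) (x : V) (y : W) :
    uqTensor hB hh ρ σ (uqF b B h i) (x ⊗ₜ y) =
      ρ (uqF b B h i) x ⊗ₜ y + ρ (uqK b B h (-simpleRoot b i)) x ⊗ₜ σ (uqF b B h i) y := by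
  simp [uqTensor, uqComul_uqF, Module.endTensorEndAlgHom_apply]

variable {hB hh ρ σ}

/-- Tensor-closedness is used only for W = V. -/
theorem finiteDimensional_of_isTensorClosed {V : Type u} [AddCommGroup V] [Module ℂ V]
    {ρ : Uq b B h →ₐ[ℂ] Module.End ℂ V} (hρ : IsInO ρ) (hc : IsTensorClosed hB hh ρ) :
    FiniteDimensional ℂ V := by
  refine (qAction hB hh hρ).finiteDimensional_of_tensor (fun _ _ => rfl)
    (qAction hB hh (hc V ρ hρ)) fun γ δ x y hx hy => ?_
  refine mem_qWt.mpr fun mu => ?_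
  rw [uqTensor_uqK, mem_qWt.mp hx, mem_qWt.mp hy, TensorProduct.smul_tmul_smul]
  rfl

/-- Let Y be the submodule generated by the products of a spanning set of V with generators of W.
The vectors y with V ⊗ y ⊆ Y form a submodule Z of W containing its generators, so Z = W. -/
theorem isFinitelyGenerated_uqTensor [FiniteDimensional ℂ V] (hσ : IsFinitelyGenerated σ) :
    IsFinitelyGenerated (uqTensor hB hh ρ σ) := by
  classical
  obtain ⟨S, hS⟩ := hσ
  obtain ⟨T, hT⟩ := (Module.finite_def (R := ℂ) (M := V)).mp inferInstance
  refine ⟨(T ×ˢ S).image fun p => p.1 ⊗ₜ p.2, ?_⟩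
  set Y := Submodule.span ℂ {w | ∃ a, ∃ v ∈ (T ×ˢ S).image fun p => p.1 ⊗ₜ[ℂ] p.2,
    w = uqTensor hB hh ρ σ a v}
  have hY : ∀ a, ∀ y ∈ Y, uqTensor hB hh ρ σ a y ∈ Y := by
    intro a y hy
    refine WeightAction.map_mem_of_mem_span (uqTensor hB hh ρ σ a) ?_ hy
    rintro _ ⟨c, v, hv, rfl⟩
    exact Submodule.subset_span ⟨a * c, v, hv, by rw [map_mul, Module.End.mul_apply]⟩
  let Z : Submodule ℂ W := ⨅ x : V, Y.comap (TensorProduct.mk ℂ V W x)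
  have hZ : ∀ y, y ∈ Z ↔ ∀ x, x ⊗ₜ[ℂ] y ∈ Y := fun y => by simp [Z]
  have hK : ∀ mu, ∀ y ∈ Z, σ (uqK b B h mu) y ∈ Z := by
    intro mu y hy
    rw [hZ] at hy ⊢
    intro x
    -- Letting x be arbitrary allows the substitution of K_(-μ) x, which cancels the action of K_μ
    -- on the first factor.
    have h1 := hY (uqK b B h mu) _ (hy (ρ (uqK b B h (-mu)) x))
    rwa [uqTensor_uqK, ← Module.End.mul_apply (ρ _), ← map_mul, uqK_mul_neg, map_one,
      Module.End.one_apply] at h1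
  have hstab : ∀ a, a ∈ stabilizerSubalgebra σ Z := by
    refine uq_mem_of_generators hK (fun i y hy => ?_) (fun i y hy => ?_)
    · rw [hZ]
      intro x
      have h1 := hY (uqE b B h i) _ ((hZ y).mp hy x)
      rw [uqTensor_uqE] at h1
      exact (Submodule.add_mem_iff_right _ ((hZ _).mp (hK (simpleRoot b i) y hy) _)).mp h1
    · rw [hZ]
      intro x
      -- Starting from K_(α_i) x makes the second term of the comultiplication exactly x ⊗ F_i y;
      -- the first lies in Y because y ∈ Z.
      have h1 := hY (uqF b B h i) _ ((hZ y).mp hy (ρ (uqK b B h (simpleRoot b i)) x))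
      rw [uqTensor_uqF, ← Module.End.mul_apply (ρ (uqK b B h (-simpleRoot b i))), ← map_mul,
        uqK_neg_mul, map_one, Module.End.one_apply] at h1
      exact (Submodule.add_mem_iff_right _ ((hZ _).mp hy _)).mp h1
  have hSZ : ∀ s ∈ S, s ∈ Z := by
    intro s hs
    rw [hZ]
    intro x
    have hx : x ∈ Submodule.span ℂ (T : Set V) := hT ▸ Submodule.mem_top
    refine (Submodule.span_le (p := Y.comap ((TensorProduct.mk ℂ V W).flip s))).mpr ?_ hx
    intro t ht
    refine Submodule.subset_span ⟨1, t ⊗ₜ s, ?_, by rw [map_one]; rfl⟩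
    exact Finset.mem_image.mpr ⟨(t, s), Finset.mem_product.mpr ⟨ht, hs⟩, rfl⟩
  have hZtop : Z = ⊤ := by
    rw [← top_le_iff, ← hS, Submodule.span_le]
    rintro _ ⟨a, v, hv, rfl⟩
    exact hstab a v (hSZ v hv)
  rw [← top_le_iff]
  intro w _
  induction w using TensorProduct.induction_on with
  | zero => exact Y.zero_mem
  | tmul x y => exact (hZ y).mp (hZtop ▸ Submodule.mem_top) x
  | add x y hx hy => exact Y.add_mem (hx trivial) (hy trivial)

theorem iSup_uqWeightSpace_uqTensor (hρ : ⨆ lam, uqWeightSpace ρ lam = ⊤)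
    (hσ : ⨆ lam, uqWeightSpace σ lam = ⊤) :
    ⨆ lam, uqWeightSpace (uqTensor hB hh ρ σ) lam = ⊤ := by
  rw [← top_le_iff]
  intro w _
  set Y := ⨆ lam, uqWeightSpace (uqTensor hB hh ρ σ) lam
  induction w using TensorProduct.induction_on with
  | zero => exact Y.zero_mem
  | add x y hx hy => exact Y.add_mem (hx trivial) (hy trivial)
  | tmul x y =>
    have h1 : ⊤ ≤ ⨅ y : W, Y.comap ((TensorProduct.mk ℂ V W).flip y) := by
      rw [← hρ]
      refine iSup_le fun lam x hx => (Submodule.mem_iInf _).mpr fun y => ?_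
      have h2 : ⊤ ≤ Y.comap (TensorProduct.mk ℂ V W x) := by
        rw [← hσ]
        refine iSup_le fun mu y hy => Submodule.mem_iSup_of_mem (lam + mu) ?_
        rw [mem_uqWeightSpace] at hx hy ⊢
        intro nu
        rw [TensorProduct.mk_apply, uqTensor_uqK, hx, hy, TensorProduct.smul_tmul_smul, ← qPow_add,
          map_add, LinearMap.add_apply]
      exact h2 (Submodule.mem_top (x := y))
    exact (Submodule.mem_iInf _).mp (h1 (Submodule.mem_top (x := x))) y

/-- For a pure tensor take V ⊗ U, with U ∋ y finite dimensional and stable under the E_i. U is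
chosen with a homogeneous spanning set, hence also stable under the K_μ that occur in the
comultiplication of E_i. -/
theorem exists_finiteDimensional_eStable [FiniteDimensional ℂ V] (hσ : IsInO σ) (v : V ⊗[ℂ] W) :
    ∃ P : Submodule ℂ (V ⊗[ℂ] W), FiniteDimensional ℂ P ∧ v ∈ P ∧
      ∀ i, uqE b B h i ∈ stabilizerSubalgebra (uqTensor hB hh ρ σ) P := by
  induction v using TensorProduct.induction_on with
  | zero =>
    exact ⟨⊥, inferInstance, Submodule.zero_mem _, fun i y hy => by
      rw [(Submodule.mem_bot ℂ).mp hy, map_zero]; exact Submodule.zero_mem _⟩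
  | add x y hx hy =>
    obtain ⟨P, hP, hxP, hstP⟩ := hx
    obtain ⟨Q, hQ, hyQ, hstQ⟩ := hy
    refine ⟨P ⊔ Q, inferInstance, Submodule.add_mem_sup hxP hyQ, fun i z hz => ?_⟩
    obtain ⟨p, hp, q, hq, rfl⟩ := Submodule.mem_sup.mp hz
    rw [map_add]
    exact Submodule.add_mem_sup (hstP i p hp) (hstQ i q hq)
  | tmul x y =>
    obtain ⟨T, hT, hyT, hstab⟩ := (qAction hB hh hσ).exists_eStable_of_finset {y}
    let U := Submodule.span ℂ (T : Set W)
    have : FiniteDimensional ℂ U := FiniteDimensional.span_of_finite ℂ T.finite_toSet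
    have hE : ∀ i, ∀ u ∈ U, σ (uqE b B h i) u ∈ U := fun i u hu =>
      WeightAction.map_mem_of_mem_span _ (hstab i) hu
    have hK : ∀ mu, ∀ u ∈ U, σ (uqK b B h mu) u ∈ U := fun mu u hu => by
      refine WeightAction.map_mem_of_mem_span _ (fun t ht => ?_) hu
      obtain ⟨γ, hγ⟩ := hT t ht
      rw [mem_qWt.mp hγ]
      exact Submodule.smul_mem _ _ (Submodule.subset_span ht)
    let P := LinearMap.range (TensorProduct.map (LinearMap.id : V →ₗ[ℂ] V) U.subtype)
    have hmem : ∀ (x : V), ∀ u ∈ U, x ⊗ₜ[ℂ] u ∈ P := fun x u hu =>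
      ⟨x ⊗ₜ ⟨u, hu⟩, by simp⟩
    refine ⟨P, inferInstance, hmem x y (hyT (by simp)), fun i z hz => ?_⟩
    obtain ⟨z, rfl⟩ := hz
    induction z using TensorProduct.induction_on with
    | zero => rw [map_zero, map_zero]; exact P.zero_mem
    | add p q hp hq => rw [map_add, map_add]; exact P.add_mem hp hq
    | tmul x u =>
      rw [TensorProduct.map_tmul, uqTensor_uqE]
      exact P.add_mem (hmem _ _ (hK _ _ u.2)) (hmem _ _ (hE _ _ u.2))

theorem isTensorClosed_of_finiteDimensional {V : Type u} [AddCommGroup V] [Module ℂ V]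
    {ρ : Uq b B h →ₐ[ℂ] Module.End ℂ V} (hρ : IsInO ρ) [FiniteDimensional ℂ V] :
    IsTensorClosed hB hh ρ := fun W _ _ σ hσ =>
  { finitelyGenerated := isFinitelyGenerated_uqTensor hσ.finitelyGenerated
    weight := iSup_uqWeightSpace_uqTensor hρ.weight hσ.weight
    locallyFinite := fun v => by
      obtain ⟨P, hP, hvP, hst⟩ :=
        exists_finiteDimensional_eStable (hB := hB) (hh := hh) (ρ := ρ) hσ v
      refine Submodule.finiteDimensional_of_le (S₂ := P) (orbitSpace_le ?_ hvP)
      refine Algebra.adjoin_le ?_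
      rintro _ ⟨i, rfl⟩
      exact hst i }

end Tensor

end QuantumModules

/-! ### Semisimple Lie algebras -/

section LieStructure

open LieAlgebra LieAlgebra.IsKilling Module LieModule

variable {g : Type u} [LieRing g] [LieAlgebra ℂ g] [FiniteDimensional ℂ g] [IsKilling ℂ g]
  {H : LieSubalgebra ℂ g} [H.IsCartanSubalgebra]

theorem smul_mem_rootSpace_span {χ : Weight ℂ H g} (hχ : χ.IsNonZero) {x y : g}
    (hx : x ∈ rootSpace H χ) (hx0 : x ≠ 0) (hy : y ∈ rootSpace H χ) : ∃ c : ℂ, c • x = y := by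
  obtain ⟨c, hc⟩ := (finrank_eq_one_iff_of_nonzero' (⟨x, hx⟩ : rootSpace H χ)
    (by simpa using hx0)).mp (finrank_rootSpace_eq_one χ hχ) ⟨y, hy⟩
  exact ⟨c, congrArg Subtype.val hc⟩

/-- The bracket `g_α × g_β → g_{α + β}` is onto if `α`, `β` and `α + β` are roots. -/
theorem exists_lie_eq_of_mem_rootSpace {α β γ : Weight ℂ H g} (hα : α.IsNonZero)
    (hγ0 : γ.IsNonZero) (hγ : (γ : H → ℂ) = α + β) {y : g} (hy : y ∈ rootSpace H γ) :
    ∃ e ∈ rootSpace H α, ∃ x ∈ rootSpace H β, ⁅e, x⁆ = y := by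
  -- z spans the top of the α-string through β and is primitive for the sl₂ of α. As α + β is a
  -- root, β lies n + 1 ≥ 1 steps below the top and γ lies n steps below it.
  obtain ⟨z, hz, hz0⟩ := (chainTop α β).exists_ne_zero
  obtain ⟨h, e, f, isSl2, he, hf⟩ := exists_isSl2Triple_of_weight_isNonZero hα
  obtain rfl := isSl2.h_eq_coroot hα he hf
  have prim : isSl2.HasPrimitiveVectorWith z (chainLength α β : ℂ) :=
    have := lie_mem_genWeightSpace_of_mem_genWeightSpace he hz
    ⟨hz0, (chainLength_smul _ _ hz).symm, by rwa [genWeightSpace_add_chainTop _ _ hα] at this⟩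
  have htop : 1 ≤ (chainTopCoeff α β : ℤ) := by
    refine ((rootSpace_zsmul_add_ne_bot_iff α β hα 1).mp ?_).1
    rw [one_smul, ← hγ]
    exact γ.genWeightSpace_ne_bot
  obtain ⟨n, hn⟩ : ∃ n, chainTopCoeff α β = n + 1 := ⟨chainTopCoeff α β - 1, by omega⟩
  have hlen : n + 1 ≤ chainLength α β := hn ▸ chainTopCoeff_le_chainLength α β
  have hmem : ∀ k, ((toEnd ℂ g g f) ^ k) z ∈ rootSpace H (k • (-⇑α) + chainTop α β) := fun k =>
    toEnd_pow_apply_mem hf hz k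
  have hxmem : ((toEnd ℂ g g f) ^ (n + 1)) z ∈ rootSpace H β := by
    have := hmem (n + 1)
    rwa [coe_chainTop, hn, natCast_zsmul, smul_neg, neg_add_cancel_left] at this
  have hymem : ((toEnd ℂ g g f) ^ n) z ∈ rootSpace H γ := by
    have := hmem n
    have h1 : n • (-⇑α) + ⇑(chainTop α β) = ⇑γ := by
      rw [coe_chainTop, hn, natCast_zsmul, smul_neg, succ_nsmul, add_assoc, neg_add_cancel_left, hγ]
    rwa [h1] at this
  -- The scalar in e f^(n+1) z = (n + 1)(length - n) f^n z, nonzero because n is smaller than the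
  -- chain length.
  have hcoef : ((n + 1) * (chainLength α β - n) : ℂ) ≠ 0 := by
    refine mul_ne_zero (Nat.cast_add_one_ne_zero n) (sub_ne_zero.mpr ?_)
    exact_mod_cast (show chainLength α β ≠ n by omega)
  obtain ⟨c, hc⟩ := smul_mem_rootSpace_span hγ0 hymem
    (prim.pow_toEnd_f_ne_zero_of_eq_nat rfl (by omega)) hy
  refine ⟨e, he, (c * ((n + 1) * (chainLength α β - n) : ℂ)⁻¹) • ((toEnd ℂ g g f) ^ (n + 1)) z,
    Submodule.smul_mem _ _ hxmem, ?_⟩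
  rw [lie_smul, prim.lie_e_pow_succ_toEnd_f, smul_smul, mul_assoc, inv_mul_cancel₀ hcoef, mul_one,
    hc]

variable (b : (rootSystem H).Base)

theorem exists_chevalley (i : b.support) : ∃ e f : g,
    IsSl2Triple ((rootSystem H).coroot i : g) e f ∧
      e ∈ rootSpace H ((rootSystem H).root i) ∧ f ∈ rootSpace H (-⇑((rootSystem H).root i)) := by
  obtain ⟨h, e, f, isSl2, he, hf⟩ :=
    exists_isSl2Triple_of_weight_isNonZero (LieSubalgebra.isNonZero_coe_root i.1)
  obtain rfl := isSl2.h_eq_coroot (LieSubalgebra.isNonZero_coe_root i.1) he hf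
  exact ⟨e, f, isSl2, he, hf⟩

/-- The raising Chevalley generators. -/
noncomputable def chevE (i : b.support) : g := (exists_chevalley b i).choose

/-- The lowering Chevalley generators. -/
noncomputable def chevF (i : b.support) : g := (exists_chevalley b i).choose_spec.choose

theorem chev_isSl2Triple (i : b.support) :
    IsSl2Triple ((rootSystem H).coroot i : g) (chevE b i) (chevF b i) :=
  (exists_chevalley b i).choose_spec.choose_spec.1

theorem chevE_mem (i : b.support) : chevE b i ∈ rootSpace H ((rootSystem H).root i) :=
  (exists_chevalley b i).choose_spec.choose_spec.2.1

theorem chevF_mem (i : b.support) : chevF b i ∈ rootSpace H (-⇑((rootSystem H).root i)) :=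
  (exists_chevalley b i).choose_spec.choose_spec.2.2

/-- The bracket has weight α_i - α_j, which is neither zero nor a root. -/
theorem lie_chevE_chevF_ne {i j : b.support} (hij : i ≠ j) : ⁅chevE b i, chevF b j⁆ = 0 := by
  have h1 := lie_mem_genWeightSpace_of_mem_genWeightSpace (chevE_mem b i) (chevF_mem b j)
  by_contra h0
  let χ : Weight ℂ H g := ⟨_, fun hbot => h0 (by rw [hbot] at h1; simpa using h1)⟩
  have hχ : χ.toLinear = (rootSystem H).root i - (rootSystem H).root j := by
    ext x
    simp [χ, sub_eq_add_neg]
  have hroot : χ.IsNonZero := by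
    intro hz
    have h2 : (rootSystem H).root i = (rootSystem H).root j := by
      rw [← sub_eq_zero, ← hχ]
      ext x
      exact congrFun hz x
    exact hij (Subtype.ext ((rootSystem H).root.injective h2))
  exact b.sub_notMem_range_root i.2 j.2 ⟨⟨χ, by simpa using hroot⟩, hχ⟩

/-- The Lie algebra is generated by the Cartan subalgebra and the Chevalley generators. -/
theorem lieSubalgebra_eq_top {S : LieSubalgebra ℂ g} (hH : H ≤ S) (hE : ∀ i, chevE b i ∈ S)
    (hF : ∀ i, chevF b i ∈ S) : S = ⊤ := by
  -- Every positive root is reached from a simple one by adding simple roots through roots; at each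
  -- stage the bracket with a simple root space is onto.
  have hpos : ∀ α : H.root, b.IsPos α → ∀ x ∈ rootSpace H α, x ∈ S := by
    intro α hα
    refine hα.induction_on_add (p := fun α => ∀ x ∈ rootSpace H α, x ∈ S) ?_ ?_
    · intro i hi x hx
      obtain ⟨c, rfl⟩ := smul_mem_rootSpace_span (LieSubalgebra.isNonZero_coe_root i)
        (chevE_mem b ⟨i, hi⟩) (chev_isSl2Triple b ⟨i, hi⟩).e_ne_zero hx
      exact S.smul_mem c (hE _)
    · intro i j k hk ih hj x hx
      obtain ⟨e, he, y, hy, rfl⟩ := exists_lie_eq_of_mem_rootSpace (α := j.1) (β := i.1) (γ := k.1)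
        (LieSubalgebra.isNonZero_coe_root j) (LieSubalgebra.isNonZero_coe_root k)
        (by
          funext t
          simpa [add_comm] using DFunLike.congr_fun hk t) hx
      obtain ⟨c, rfl⟩ := smul_mem_rootSpace_span (LieSubalgebra.isNonZero_coe_root j)
        (chevE_mem b ⟨j, hj⟩) (chev_isSl2Triple b ⟨j, hj⟩).e_ne_zero he
      exact S.lie_mem (S.smul_mem c (hE _)) (ih y hy)
  have hneg : ∀ α : H.root, b.IsPos α → ∀ x ∈ rootSpace H (-(α : Weight ℂ H g)), x ∈ S := by
    intro α hα
    have hnz : ∀ i : H.root, (-(i : Weight ℂ H g)).IsNonZero := fun i =>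
      (LieSubalgebra.isNonZero_coe_root i).neg
    refine hα.induction_on_add
      (p := fun α => ∀ x ∈ rootSpace H (-(α : Weight ℂ H g)), x ∈ S) ?_ ?_
    · intro i hi x hx
      obtain ⟨c, rfl⟩ := smul_mem_rootSpace_span (hnz i)
        (by simpa using chevF_mem b ⟨i, hi⟩) (chev_isSl2Triple b ⟨i, hi⟩).f_ne_zero
        (by simpa using hx)
      exact S.smul_mem c (hF _)
    · intro i j k hk ih hj x hx
      obtain ⟨e, he, y, hy, rfl⟩ := exists_lie_eq_of_mem_rootSpace (α := -j.1) (β := -i.1)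
        (γ := -k.1) (hnz j) (hnz k)
        (by
          funext t
          have h1 : k.1 t = i.1 t + j.1 t := by simpa using DFunLike.congr_fun hk t
          simp only [Weight.coe_neg, Pi.add_apply, Pi.neg_apply, h1]
          ring) (by simpa using hx)
      obtain ⟨c, rfl⟩ := smul_mem_rootSpace_span (hnz j)
        (by simpa using chevF_mem b ⟨j, hj⟩) (chev_isSl2Triple b ⟨j, hj⟩).f_ne_zero he
      exact S.lie_mem (S.smul_mem c (hF _)) (ih y (by simpa using hy))
  rw [← LieSubalgebra.toSubmodule_inj, LieSubalgebra.top_toSubmodule, ← top_le_iff]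
  have htop : (⊤ : Submodule ℂ g) = ⨆ χ : Weight ℂ H g, (rootSpace H χ).toSubmodule := by
    have := congrArg LieSubmodule.toSubmodule (iSup_genWeightSpace_eq_top' ℂ H g)
    rw [LieSubmodule.iSup_toSubmodule, LieSubmodule.top_toSubmodule] at this
    exact this.symm
  rw [htop]
  refine iSup_le fun χ x hx => ?_
  by_cases hχ : χ.IsZero
  · have h1 : x ∈ rootSpace H (0 : H → ℂ) := by
      rw [← hχ]
      exact hx
    refine hH ?_
    rw [rootSpace_zero_eq ℂ g H] at h1
    simpa using h1
  · have hmem : χ ∈ H.root := by simpa using hχ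
    rcases RootPairing.Base.IsPos.or_neg b (⟨χ, hmem⟩ : H.root) with hp | hp
    · exact hpos _ hp x hx
    · refine hneg _ hp x ?_
      -- The reflection of χ in itself is -χ, which identifies the root space of χ with the one
      -- treated in `hneg`.
      have h1 := ((rootSystem H).root_reflectionPerm ⟨χ, hmem⟩ ⟨χ, hmem⟩).trans
        ((rootSystem H).reflection_apply_self _)
      have h2 : -⇑((rootSystem H).reflectionPerm ⟨χ, hmem⟩ ⟨χ, hmem⟩ : H.root).1 = ⇑χ := by
        funext t
        have := DFunLike.congr_fun h1 t
        simp only [rootSystem_root_apply, LinearMap.neg_apply, Weight.toLinear_apply] at this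
        rw [Pi.neg_apply, this, neg_neg]
      rw [← h2] at hx
      exact hx

end LieStructure

/-! ### Modules over the Lie algebra as weight-graded spaces -/

section ClassicalModules

open LieAlgebra LieAlgebra.IsKilling Module LieModule

variable {g : Type u} [LieRing g] [LieAlgebra ℂ g] [FiniteDimensional ℂ g] [IsKilling ℂ g]
  {H : LieSubalgebra ℂ g} [H.IsCartanSubalgebra] {b : (rootSystem H).Base}
  {M : Type*} [AddCommGroup M] [Module ℂ M] [LieRingModule g M] [LieModule ℂ g M]
  {N : Type*} [AddCommGroup N] [Module ℂ N] [LieRingModule g N] [LieModule ℂ g N]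

/-- The weight datum of the semisimple Lie algebra `g`. -/
noncomputable def lieDatum (b : (rootSystem H).Base) : WeightDatum b.support (Dual ℂ H) where
  α := fun i => (rootSystem H).root i
  φ := fun i γ => γ ((rootSystem H).coroot i)
  A := cartanEntry b
  D := fun i γ m => γ ((rootSystem H).coroot i) = m
  linInd := by
    rw [Fintype.linearIndependent_iff]
    intro n hn i
    have hli := b.toWeightBasis.linearIndependent
    rw [Fintype.linearIndependent_iff] at hli
    have := hli (fun i => (n i : ℂ)) (by simpa [Int.cast_smul_eq_zsmul] using hn) i
    exact_mod_cast this
  A_self := fun i => by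
    have := root_apply_coroot_eq b i i
    exact_mod_cast this.symm.trans ((rootSystem H).root_coroot_two i)
  D_of_sum_eq_zero := by
    intro i γ n hsum
    have h2 : (rootSystem H).root i ((rootSystem H).coroot i) = (2 : ℂ) :=
      (rootSystem H).root_coroot_two i
    -- Here n counts the terms. The hypothesis has n + 1 of them, so the second factor vanishes
    -- exactly when the coroot value is n.
    have key : ∀ n : ℕ, ∑ k ∈ Finset.range n,
        (γ - k • (rootSystem H).root i) ((rootSystem H).coroot i) =
          n * (γ ((rootSystem H).coroot i) - n + 1) := by
      intro n
      induction n with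
      | zero => simp
      | succ n ih =>
        rw [Finset.sum_range_succ, ih, LinearMap.sub_apply, LinearMap.smul_apply, h2]
        push_cast
        simp only [nsmul_eq_mul]
        ring
    rw [key] at hsum
    have h3 := (mul_eq_zero.mp hsum).resolve_left (Nat.cast_ne_zero.mpr n.succ_ne_zero)
    push_cast at h3 ⊢
    linear_combination h3
  D_sub := fun i j γ m hm => by
    rw [LinearMap.sub_apply, hm, root_apply_coroot_eq, Int.cast_sub]
  D_add := fun i j γ m hm => by
    rw [LinearMap.add_apply, hm, root_apply_coroot_eq, Int.cast_add]
  D_unique := fun i γ m m' hm hm' => by exact_mod_cast hm.symm.trans hm'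

theorem uea_mem_of_generators {S : Subalgebra ℂ (UniversalEnvelopingAlgebra ℂ g)}
    (hS : ∀ x, UniversalEnvelopingAlgebra.ι ℂ x ∈ S) (a : UniversalEnvelopingAlgebra ℂ g) :
    a ∈ S := by
  obtain ⟨x, rfl⟩ : ∃ x, UniversalEnvelopingAlgebra.mkAlgHom ℂ g x = a :=
    RingCon.mk'_surjective (c := UniversalEnvelopingAlgebra.ringCon ℂ g) a
  induction x using TensorAlgebra.induction with
  | algebraMap r => rw [AlgHom.commutes]; exact S.algebraMap_mem r
  | ι x => exact hS x
  | mul x y hx hy => rw [map_mul]; exact S.mul_mem hx hy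
  | add x y hx hy => rw [map_add]; exact S.add_mem hx hy

theorem lieAction_ι (x : g) (m : M) :
    lieAction g M (UniversalEnvelopingAlgebra.ι ℂ x) m = ⁅x, m⁆ := by
  rw [lieAction, UniversalEnvelopingAlgebra.lift_ι_apply, toEnd_apply_apply]

/-- The weight spaces of a `g`-module. -/
def lieWt (M : Type*) [AddCommGroup M] [Module ℂ M] [LieRingModule g M] [LieModule ℂ g M]
    (γ : Dual ℂ H) : Submodule ℂ M := (LieModule.weightSpace M (γ : H → ℂ)).toSubmodule

theorem mem_lieWt {γ : Dual ℂ H} {x : M} : x ∈ lieWt M γ ↔ ∀ t : H, ⁅(t : g), x⁆ = γ t • x :=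
  mem_weightSpace _ x

theorem iSupIndep_lieWt : iSupIndep (lieWt (H := H) M) := by
  have h1 := LieSubmodule.iSupIndep_toSubmodule.mpr (iSupIndep_genWeightSpace ℂ H M)
  have h2 := h1.comp (f := fun γ : Dual ℂ H => (γ : H → ℂ)) DFunLike.coe_injective
  refine iSupIndep.mono h2 ?_
  intro γ
  exact weightSpace_le_genWeightSpace M (γ : H → ℂ)

theorem lie_mem_lieWt {χ : H → ℂ} {α γ δ : Dual ℂ H} {x : g} {m : M} (hχ : χ = α)
    (hx : x ∈ rootSpace H χ) (hm : m ∈ lieWt M γ) (hδ : δ = γ + α) : ⁅x, m⁆ ∈ lieWt M δ := by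
  rw [mem_lieWt] at hm ⊢
  intro t
  have h1 : ⁅(t : g), x⁆ = χ t • x := lie_eq_smul_of_mem_rootSpace hx t
  rw [leibniz_lie, h1, hm, smul_lie, lie_smul, ← add_smul, hδ, hχ, LinearMap.add_apply, add_comm]

/-- Left and right multiplication by x commute, so this is the binomial theorem for the powers of ad
x. -/
theorem mulLeft_sub_mulRight_pow {A : Type*} [Ring A] [Algebra ℂ A] (x z : A) (n : ℕ) :
    ((LinearMap.mulLeft ℂ x - LinearMap.mulRight ℂ x : Module.End ℂ A) ^ n) z =
      ∑ k ∈ Finset.range (n + 1),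
        ((-1 : ℂ) ^ k * n.choose k) • (x ^ (n - k) * (z * x ^ k)) := by
  have hc : Commute (LinearMap.mulLeft ℂ x : Module.End ℂ A)
      (-(LinearMap.mulRight ℂ x : Module.End ℂ A)) :=
    Commute.neg_right (R := Module.End ℂ A) (LinearMap.commute_mulLeft_right x x)
  rw [sub_eq_add_neg, add_comm, hc.symm.add_pow, LinearMap.sum_apply]
  refine Finset.sum_congr rfl fun k _ => ?_
  have h1 : (-(LinearMap.mulRight ℂ x : Module.End ℂ A)) ^ k =
      (-1 : ℂ) ^ k • LinearMap.mulRight ℂ (x ^ k) := by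
    rw [← LinearMap.pow_mulRight, ← smul_pow, neg_one_smul]
  rw [h1, LinearMap.pow_mulLeft, (Nat.cast_commute (n.choose k) _).eq.symm,
    ← nsmul_eq_mul, LinearMap.smul_apply, Module.End.mul_apply, LinearMap.smul_apply,
    LinearMap.mulRight_apply, LinearMap.mulLeft_apply, ← Nat.cast_smul_eq_nsmul ℂ, smul_smul,
    mul_comm, mul_assoc]

/-- Nilpotency of ad f_i replaces the Serre relation: (ad f_i)^n f_j = 0 is expanded in the
endomorphisms of M and solved for f_j f_i^n. The sharp exponent 1 - a_ij is not needed. -/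
theorem exists_chevF_mul_pow (b : (rootSystem H).Base) (i j : b.support) :
    ∃ (n : ℕ) (c : ℕ → ℂ), ∀ m : M, ⁅chevF b j, ((toEnd ℂ g M (chevF b i)) ^ n) m⁆ =
      ∑ k ∈ Finset.range n, c k • ((toEnd ℂ g M (chevF b i)) ^ (n - k))
        ⁅chevF b j, ((toEnd ℂ g M (chevF b i)) ^ k) m⁆ := by
  obtain ⟨n, hn⟩ := isNilpotent_ad_of_mem_rootSpace (K := ℂ) H
    (neg_ne_zero.mpr (LieSubalgebra.isNonZero_coe_root i.1)) (chevF_mem b i)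
  have h0 : ∀ x y : g, toEnd ℂ g M ⁅x, y⁆ =
      toEnd ℂ g M x * toEnd ℂ g M y - toEnd ℂ g M y * toEnd ℂ g M x := fun x y => by
    ext m
    exact lie_lie x y m
  have h1 : ∀ n : ℕ, ((LinearMap.mulLeft ℂ (toEnd ℂ g M (chevF b i)) -
      LinearMap.mulRight ℂ (toEnd ℂ g M (chevF b i)) : Module.End ℂ (Module.End ℂ M)) ^ n)
        (toEnd ℂ g M (chevF b j)) =
      toEnd ℂ g M (((ad ℂ g (chevF b i)) ^ n) (chevF b j)) := by
    intro n
    induction n with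
    | zero => simp
    | succ n ih =>
      rw [pow_succ', pow_succ', Module.End.mul_apply, ih, Module.End.mul_apply, ad_apply, h0]
      rfl
  have h2 := h1 n
  rw [hn, LinearMap.zero_apply, map_zero, mulLeft_sub_mulRight_pow, Finset.sum_range_succ,
    Nat.sub_self, pow_zero, one_mul, Nat.choose_self, Nat.cast_one, mul_one, add_comm] at h2
  refine ⟨n, fun k => -((-1) ^ n * ((-1) ^ k * n.choose k)), fun m => ?_⟩
  have h3 := congrArg (fun x => ((-1 : ℂ) ^ n • x) m) (eq_neg_of_add_eq_zero_left h2)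
  simp only [smul_smul, ← mul_pow, neg_one_mul, neg_neg, one_pow, one_smul] at h3
  refine h3.trans ?_
  simp only [LinearMap.smul_apply, LinearMap.neg_apply, LinearMap.sum_apply, Module.End.mul_apply,
    smul_neg, Finset.smul_sum, smul_smul, ← Finset.sum_neg_distrib, neg_smul, toEnd_apply_apply]

theorem chevE_mem_lieNPlus (i : b.support) :
    UniversalEnvelopingAlgebra.ι ℂ (chevE b i) ∈ lieNPlus b :=
  Algebra.subset_adjoin ⟨_, ⟨i, b.isPos_of_mem_support i.2, chevE_mem b i⟩, rfl⟩

/-- An object of the category `O` of `g` as a weight-graded space. -/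
noncomputable def lieActionWeight (hM : IsInLieO b M) : WeightAction (lieDatum b) M where
  wt := lieWt M
  e := fun i => toEnd ℂ g M (chevE b i)
  f := fun i => toEnd ℂ g M (chevF b i)
  indep := iSupIndep_lieWt
  iSup_wt := hM.weight
  e_mem := fun i γ x hx => lie_mem_lieWt rfl (chevE_mem b i) hx rfl
  f_mem := fun i γ x hx => lie_mem_lieWt (α := -(rootSystem H).root i) rfl (chevF_mem b i) hx
    (sub_eq_add_neg _ _)
  comm_same := by
    intro i γ x hx
    have h1 := mem_lieWt.mp hx ((rootSystem H).coroot i)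
    rw [← (chev_isSl2Triple b i).lie_e_f, lie_lie, sub_eq_iff_eq_add'] at h1
    exact h1
  comm_ne := by
    intro i j hij x
    have h1 : ⁅⁅chevE b i, chevF b j⁆, x⁆ = 0 := by rw [lie_chevE_chevF_ne b hij, zero_lie]
    rw [lie_lie, sub_eq_zero] at h1
    exact h1
  eFinite := by
    intro v
    have := hM.locallyFinite v
    refine Submodule.finiteDimensional_of_le (S₂ := orbitSpace (lieNPlus b) (lieAction g M) v)
      (Submodule.span_le.mpr ?_)
    rintro _ ⟨w, rfl⟩
    refine mem_orbitSpace.mpr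
      ⟨(w.map fun i => UniversalEnvelopingAlgebra.ι ℂ (chevE b i)).prod, ?_, ?_⟩
    · refine Subalgebra.list_prod_mem _ fun a ha => ?_
      obtain ⟨i, -, rfl⟩ := List.mem_map.mp ha
      exact chevE_mem_lieNPlus i
    · rw [map_list_prod, List.map_map]
      congr 2
      refine congrArg (fun φ => List.map φ w) (funext fun i => ?_)
      ext m
      exact lieAction_ι _ m
  fg := by
    obtain ⟨S, hS⟩ := hM.finitelyGenerated
    refine ⟨S, fun Y hSY he hf hwt => ?_⟩
    -- The stabilizer of Y in g. It contains H because Y is graded, and the Chevalley generators by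
    -- assumption, so it is all of g.
    let L : LieSubalgebra ℂ g :=
      { carrier := {x | ∀ y ∈ Y, ⁅x, y⁆ ∈ Y}
        zero_mem' := fun y _ => by rw [zero_lie]; exact Y.zero_mem
        add_mem' := fun {x x'} hx hx' y hy => by
          rw [add_lie]; exact Y.add_mem (hx y hy) (hx' y hy)
        smul_mem' := fun c x hx y hy => by rw [smul_lie]; exact Y.smul_mem c (hx y hy)
        lie_mem' := fun {x x'} hx hx' y hy => by
          rw [lie_lie]; exact Y.sub_mem (hx _ (hx' y hy)) (hx' _ (hx y hy)) }
    have hL : L = ⊤ := by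
      refine lieSubalgebra_eq_top b (fun t ht y hy => ?_) (fun i y hy => he i y hy)
        (fun i y hy => hf i y hy)
      have : (⨆ γ, Y ⊓ lieWt (H := H) M γ) ≤ Y.comap (toEnd ℂ g M t) := by
        refine iSup_le fun γ y hy => ?_
        rw [Submodule.mem_comap, toEnd_apply_apply, mem_lieWt.mp hy.2 ⟨t, ht⟩]
        exact Y.smul_mem _ hy.1
      exact this (hwt hy)
    have hstab : ∀ a, a ∈ stabilizerSubalgebra (lieAction g M) Y :=
      uea_mem_of_generators fun x y hy => by
        rw [lieAction_ι]
        exact (show x ∈ L from hL ▸ LieSubalgebra.mem_top x) y hy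
    rw [← top_le_iff, ← hS, Submodule.span_le]
    rintro _ ⟨a, v, hv, rfl⟩
    exact hstab a v (hSY hv)
  serre := fun i j _ => exists_chevF_mul_pow b i j

theorem finiteDimensional_of_isLieTensorClosed {M : Type u} [AddCommGroup M] [Module ℂ M]
    [LieRingModule g M] [LieModule ℂ g M] (hM : IsInLieO b M) (hc : IsLieTensorClosed b M) :
    FiniteDimensional ℂ M := by
  refine (lieActionWeight hM).finiteDimensional_of_tensor (fun _ _ => rfl)
    (lieActionWeight (hc M hM)) fun γ δ x y hx hy => ?_
  refine mem_lieWt.mpr fun t => ?_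
  rw [TensorProduct.LieModule.lie_tmul_right, mem_lieWt.mp hx, mem_lieWt.mp hy,
    TensorProduct.smul_tmul, ← TensorProduct.tmul_add, ← add_smul, TensorProduct.tmul_smul]
  rfl

/-! ### Tensor products with finite-dimensional Lie algebra modules -/

theorem isFinitelyGenerated_lieTensor [FiniteDimensional ℂ M]
    (hN : IsFinitelyGenerated (lieAction g N)) : IsFinitelyGenerated (lieAction g (M ⊗[ℂ] N)) := by
  classical
  obtain ⟨S, hS⟩ := hN
  obtain ⟨T, hT⟩ := (Module.finite_def (R := ℂ) (M := M)).mp inferInstance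
  refine ⟨(T ×ˢ S).image fun p => p.1 ⊗ₜ p.2, ?_⟩
  set Y := Submodule.span ℂ {w | ∃ a, ∃ v ∈ (T ×ˢ S).image fun p => p.1 ⊗ₜ[ℂ] p.2,
    w = lieAction g (M ⊗[ℂ] N) a v}
  have hY : ∀ x : g, ∀ y ∈ Y, ⁅x, y⁆ ∈ Y := by
    intro x y hy
    rw [← lieAction_ι]
    refine WeightAction.map_mem_of_mem_span (lieAction g (M ⊗[ℂ] N) _) ?_ hy
    rintro _ ⟨c, v, hv, rfl⟩
    exact Submodule.subset_span ⟨_ * c, v, hv, by rw [map_mul, Module.End.mul_apply]⟩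
  let Z : Submodule ℂ N := ⨅ x : M, Y.comap (TensorProduct.mk ℂ M N x)
  have hZ : ∀ y, y ∈ Z ↔ ∀ x, x ⊗ₜ[ℂ] y ∈ Y := fun y => by simp [Z]
  -- In x(m ⊗ y) = xm ⊗ y + m ⊗ xy the left side and the first term lie in Y, hence so does the
  -- last.
  have hstab : ∀ a, a ∈ stabilizerSubalgebra (lieAction g N) Z :=
    uea_mem_of_generators fun x y hy => by
      rw [lieAction_ι, hZ]
      intro m
      have h1 := hY x _ ((hZ y).mp hy m)
      rw [TensorProduct.LieModule.lie_tmul_right] at h1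
      exact (Submodule.add_mem_iff_right _ ((hZ _).mp hy _)).mp h1
  have hSZ : ∀ s ∈ S, s ∈ Z := by
    intro s hs
    rw [hZ]
    intro x
    have hx : x ∈ Submodule.span ℂ (T : Set M) := hT ▸ Submodule.mem_top
    refine (Submodule.span_le (p := Y.comap ((TensorProduct.mk ℂ M N).flip s))).mpr ?_ hx
    intro t ht
    refine Submodule.subset_span ⟨1, t ⊗ₜ s, ?_, by rw [map_one]; rfl⟩
    exact Finset.mem_image.mpr ⟨(t, s), Finset.mem_product.mpr ⟨ht, hs⟩, rfl⟩
  have hZtop : Z = ⊤ := by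
    rw [← top_le_iff, ← hS, Submodule.span_le]
    rintro _ ⟨a, v, hv, rfl⟩
    exact hstab a v (hSZ v hv)
  rw [← top_le_iff]
  intro w _
  induction w using TensorProduct.induction_on with
  | zero => exact Y.zero_mem
  | tmul x y => exact (hZ y).mp (hZtop ▸ Submodule.mem_top) x
  | add x y hx hy => exact Y.add_mem (hx trivial) (hy trivial)

theorem iSup_lieWt_tensor (hM : ⨆ lam, lieWt (H := H) M lam = ⊤)
    (hN : ⨆ lam, lieWt (H := H) N lam = ⊤) : ⨆ lam, lieWt (H := H) (M ⊗[ℂ] N) lam = ⊤ := by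
  rw [← top_le_iff]
  intro w _
  set Y := ⨆ lam, lieWt (H := H) (M ⊗[ℂ] N) lam
  induction w using TensorProduct.induction_on with
  | zero => exact Y.zero_mem
  | add x y hx hy => exact Y.add_mem (hx trivial) (hy trivial)
  | tmul x y =>
    have h1 : ⊤ ≤ ⨅ y : N, Y.comap ((TensorProduct.mk ℂ M N).flip y) := by
      rw [← hM]
      refine iSup_le fun lam x hx => (Submodule.mem_iInf _).mpr fun y => ?_
      have h2 : ⊤ ≤ Y.comap (TensorProduct.mk ℂ M N x) := by
        rw [← hN]
        refine iSup_le fun mu y hy => Submodule.mem_iSup_of_mem (lam + mu) ?_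
        rw [mem_lieWt] at hx hy ⊢
        intro t
        rw [TensorProduct.mk_apply, TensorProduct.LieModule.lie_tmul_right, hx, hy,
          TensorProduct.smul_tmul, ← TensorProduct.tmul_add, ← add_smul, TensorProduct.tmul_smul]
        rfl
      exact h2 (Submodule.mem_top (x := y))
    exact (Submodule.mem_iInf _).mp (h1 (Submodule.mem_top (x := x))) y

/-- For a pure tensor m ⊗ n take M ⊗ U, where U is the U(𝔫₊)-orbit of n. By the Leibniz rule no
stability under H is needed, in contrast to the quantum case. -/
theorem exists_finiteDimensional_stable [FiniteDimensional ℂ M]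
    (hN : IsLocallyFinite (lieNPlus b) (lieAction g N)) (v : M ⊗[ℂ] N) :
    ∃ P : Submodule ℂ (M ⊗[ℂ] N), FiniteDimensional ℂ P ∧ v ∈ P ∧
      ∀ x : g, UniversalEnvelopingAlgebra.ι ℂ x ∈ lieNPlus b → ∀ z ∈ P, ⁅x, z⁆ ∈ P := by
  induction v using TensorProduct.induction_on with
  | zero =>
    exact ⟨⊥, inferInstance, Submodule.zero_mem _, fun x _ z hz => by
      rw [(Submodule.mem_bot ℂ).mp hz, lie_zero]; exact Submodule.zero_mem _⟩
  | add x y hx hy =>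
    obtain ⟨P, hP, hxP, hstP⟩ := hx
    obtain ⟨Q, hQ, hyQ, hstQ⟩ := hy
    refine ⟨P ⊔ Q, inferInstance, Submodule.add_mem_sup hxP hyQ, fun x hx z hz => ?_⟩
    obtain ⟨p, hp, q, hq, rfl⟩ := Submodule.mem_sup.mp hz
    rw [lie_add]
    exact Submodule.add_mem_sup (hstP x hx p hp) (hstQ x hx q hq)
  | tmul m n =>
    let U := orbitSpace (lieNPlus b) (lieAction g N) n
    have : FiniteDimensional ℂ U := hN n
    have hU : ∀ x : g, UniversalEnvelopingAlgebra.ι ℂ x ∈ lieNPlus b → ∀ u ∈ U, ⁅x, u⁆ ∈ U :=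
      fun x hx u hu => by
        rw [← lieAction_ι]
        exact le_stabilizer_orbitSpace _ _ n hx u hu
    let P := LinearMap.range (TensorProduct.map (LinearMap.id : M →ₗ[ℂ] M) U.subtype)
    have hmem : ∀ (m : M), ∀ u ∈ U, m ⊗ₜ[ℂ] u ∈ P := fun m u hu => ⟨m ⊗ₜ ⟨u, hu⟩, by simp⟩
    refine ⟨P, inferInstance, hmem m n (mem_orbitSpace.mpr ⟨1, one_mem _, by simp⟩),
      fun x hx z hz => ?_⟩
    obtain ⟨z, rfl⟩ := hz
    induction z using TensorProduct.induction_on with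
    | zero => rw [map_zero, lie_zero]; exact P.zero_mem
    | add p q hp hq => rw [map_add, lie_add]; exact P.add_mem hp hq
    | tmul m u =>
      rw [TensorProduct.map_tmul, TensorProduct.LieModule.lie_tmul_right]
      exact P.add_mem (hmem _ _ u.2) (hmem _ _ (hU x hx _ u.2))

theorem isLieTensorClosed_of_finiteDimensional {M : Type u} [AddCommGroup M] [Module ℂ M]
    [LieRingModule g M] [LieModule ℂ g M] (hM : IsInLieO b M) [FiniteDimensional ℂ M] :
    IsLieTensorClosed b M := fun N _ _ _ _ hN =>
  { finitelyGenerated := isFinitelyGenerated_lieTensor hN.finitelyGenerated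
    weight := iSup_lieWt_tensor hM.weight hN.weight
    locallyFinite := fun v => by
      obtain ⟨P, hP, hvP, hst⟩ := exists_finiteDimensional_stable (M := M) hN.locallyFinite v
      refine Submodule.finiteDimensional_of_le (S₂ := P) (orbitSpace_le ?_ hvP)
      refine Algebra.adjoin_le ?_
      rintro _ ⟨x, hx, rfl⟩ z hz
      rw [lieAction_ι]
      exact hst x (Algebra.subset_adjoin ⟨x, hx, rfl⟩) z hz }

end ClassicalModules

end CategoryO

open CategoryO in
theorem mainTheorem1 {g : Type u} [LieRing g] [LieAlgebra ℂ g] [FiniteDimensional ℂ g]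
    [LieAlgebra.IsSemisimple ℂ g] (H : LieSubalgebra ℂ g) [H.IsCartanSubalgebra]
    (b : (LieAlgebra.IsKilling.rootSystem H).Base) :
    (∀ (B : LinearMap.BilinForm ℂ (Module.Dual ℂ H)) (hB : IsRescaledKillingForm B)
        (h : ℝ) (hh : h ≠ 0) (V : Type u) [AddCommGroup V] [Module ℂ V]
        (ρ : Uq b B h →ₐ[ℂ] Module.End ℂ V),
        IsInO ρ → (IsTensorClosed hB hh ρ ↔ FiniteDimensional ℂ V)) ∧
    (∀ (M : Type u) [AddCommGroup M] [Module ℂ M] [LieRingModule g M] [LieModule ℂ g M],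
        IsInLieO b M → (IsLieTensorClosed b M ↔ FiniteDimensional ℂ M)) := by
  refine ⟨fun B hB h hh V _ _ ρ hρ => ⟨fun hc => finiteDimensional_of_isTensorClosed hρ hc,
      fun _ => isTensorClosed_of_finiteDimensional hρ⟩,
    fun M _ _ _ _ hM => ⟨fun hc => finiteDimensional_of_isLieTensorClosed hM hc,
      fun _ => isLieTensorClosed_of_finiteDimensional hM⟩⟩
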